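/- **Proposition (Inverse Geronimus Relations).** Let $\mu$ be a probability measure on the unit circle $\partial\mathbb D$ that is nontrivial (not supported on a finite set) and invariant under complex conjugation. Let $\Phi_n$ be its monic orthogonal polynomials and $\alpha_n=-\overline{\Phi_{n+1}(0)}$ $(n\ge 0)$ its Verblunsky coefficients (which are real), with the convention $\alpha_{-1}=-1$. Let $Sz^{(e)}(\mu)$ be the image of $\mu$ under $e^{i\theta}\mapsto 2\cos\theta$, and put $$Sz^{(o)}(\mu)=c^2(4-x^2)\,Sz^{(e)}(\mu),\qquad Sz^{(\pm)}(\mu)=c_\pm^2(2\mp x)\,Sz^{(e)}(\mu),$$ $$c=\frac1{\sqrt{2(1-|\alpha_0|^2)(1-\alpha_1)}},\qquad c_\pm=\frac1{\sqrt{2(1\mp\alpha_0)}}.$$ For $\ast\in\{e,o,+,-\}$ write $\nu^{(\ast)}=Sz^{(\ast)}(\mu)$. Let $P^{(\ast)}_n$ be the monic orthogonal polynomials of $\nu^{(\ast)}$. With $a_n,b_n$ the Jacobi parameters of $\nu^{(\ast)}$, i.e. $a_n=\|P_n^{(\ast)}\|/\|P_{n-1}^{(\ast)}\|$ for $n\ge1$,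 $a_0=1$ and $b_{n+1}=\langle xP_n^{(\ast)},P_n^{(\ast)}\rangle/\|P_n^{(\ast)}\|^2$ for $n\ge0$ (norms and inner products in $L^2(\nu^{(\ast)})$), let $Q^{(\ast)}_n$ be the second-kind polynomials, which solve $Q_{n+1}=(x-b_{n+1})Q_n-a_n^2Q_{n-1}$ with $Q_{-1}=-1$, $Q_0=0$. Let $m^{(\ast)}(x)=\int \frac{d\nu^{(\ast)}(t)}{t-x}$. We say that $m^{(\ast)}(x)$ is finite if $\int\frac{d\nu^{(\ast)}(t)}{|t-x|}<\infty$ (with $1/0=\infty$), and in this case put $F^{(\ast)}_n(x)=m^{(\ast)}(x)P^{(\ast)}_n(x)+Q^{(\ast)}_n(x)$. Define $$A^{(\ast)}_n=-\frac{P^{(\ast)}_{n+1}(-2)}{P^{(\ast)}_n(-2)},\quad B^{(\ast)}_n=\frac{P^{(\ast)}_{n+1}(2)}{P^{(\ast)}_n(2)},\quad C^{(\ast)}_n=-\frac{F^{(\ast)}_{n+1}(-2)}{F^{(\ast)}_n(-2)},\quad D^{(\ast)}_n=\frac{F^{(\ast)}_{n+1}(2)}{F^{(\ast)}_n(2)}.$$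 Then, for every $\ast\in\{e,o,+,-\}$ and $n\ge0$, $P^{(\ast)}_n(\pm2)\ne0$; and $F^{(\ast)}_n(2)\neq 0$ if $m^{(\ast)}(2)$ is finite, $F^{(\ast)}_n(-2)\ne0$ if $m^{(\ast)}(-2)$ is finite. Moreover, for all $n\ge 0$ (all denominators below being nonzero): * $(e)$: $\displaystyle \alpha_{2n}=\frac{A^{(e)}_n-B^{(e)}_n}{A^{(e)}_n+B^{(e)}_n},\qquad \alpha_{2n-1}=1-\tfrac12\bigl(A^{(e)}_n+B^{(e)}_n\bigr).$ * $(o)$: if $\mu(\{1\})=\mu(\{-1\})=0$, then $m^{(o)}(2)$ and $m^{(o)}(-2)$ are finite and $\displaystyle -\alpha_{2n+2}=\frac{C^{(o)}_n-D^{(o)}_n}{C^{(o)}_n+D^{(o)}_n},\qquad -\alpha_{2n+1}=1-\tfrac12\bigl(C^{(o)}_n+D^{(o)}_n\bigr).$ * $(+)$: if $\mu(\{1\})=0$, then $m^{(+)}(2)$ is finite and $\displaystyle -\alpha_{2n+1}=\frac{A^{(+)}_n-D^{(+)}_n}{A^{(+)}_n+D^{(+)}_n},\qquad -\alpha_{2n}=1-\tfrac12\bigl(A^{(+)}_n+D^{(+)}_n\bigr).$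 * $(-)$: if $\mu(\{-1\})=0$, then $m^{(-)}(-2)$ is finite and $\displaystyle \alpha_{2n+1}=\frac{C^{(-)}_n-B^{(-)}_n}{C^{(-)}_n+B^{(-)}_n},\qquad \alpha_{2n}=1-\tfrac12\bigl(C^{(-)}_n+B^{(-)}_n\bigr).$ -/

import Mathlib

open MeasureTheory Polynomial

/-- The unit circle carries its Borel sigma-algebra. -/
noncomputable instance circleMeasurableSpace : MeasurableSpace Circle := borel Circle

instance circleBorelSpace : BorelSpace Circle := ⟨rfl⟩

namespace InverseGeronimus

noncomputable section

/-! ### Measures on the circle and their Verblunsky coefficients -/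

/-- A measure is nontrivial if it is not supported on a finite set of points. -/
def NontrivialMeasure {X : Type*} [MeasurableSpace X] (μ : Measure X) : Prop :=
  ∀ s : Set X, s.Finite → μ sᶜ ≠ 0

/-- Invariance under complex conjugation (on the unit circle the inverse is the conjugate). -/
def ConjInvariant (μ : Measure Circle) : Prop :=
  μ.map (fun z : Circle => z⁻¹) = μ

/-- The monic orthogonal polynomials `Φ_n` of a measure on the circle, obtained from
`1, z, z², …` by the Gram-Schmidt procedure (without normalization) in `L²(μ)`. -/
def circleOP (μ : Measure Circle) : ℕ → ℂ[X]
  | n => X ^ n - ∑ k : Fin n,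
      C ((∫ z : Circle, (starRingEnd ℂ) ((circleOP μ k).eval (z : ℂ)) * (z : ℂ) ^ n ∂μ) /
        ((∫ z : Circle, ‖(circleOP μ k).eval (z : ℂ)‖ ^ 2 ∂μ : ℝ) : ℂ)) * circleOP μ k
termination_by n => n
decreasing_by all_goals exact k.2

/-- The Verblunsky coefficients: `α_n = - conj (Φ_{n+1}(0))` for `n ≥ 0`, with the convention
`α_{-1} = -1` (the values at indices below `-1` are never used). -/
def verblunsky (μ : Measure Circle) : ℤ → ℂ
  | Int.ofNat n => -(starRingEnd ℂ) ((circleOP μ (n + 1)).eval 0)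
  | Int.negSucc _ => -1

/-! ### The four Szegő mappings -/

/-- The labels `e, o, +, -`. -/
inductive SzegoType
  | e
  | o
  | plus
  | minus

/-- `Sz^{(e)}(μ)`: the image of `μ` under `e^{iθ} ↦ 2 cos θ`. -/
def szegoE (μ : Measure Circle) : Measure ℝ :=
  μ.map (fun z : Circle => 2 * (z : ℂ).re)

/-- `c = 1 / √(2 (1 - |α₀|²) (1 - α₁))`. -/
def cO (μ : Measure Circle) : ℝ :=
  1 / Real.sqrt (2 * (1 - ‖verblunsky μ 0‖ ^ 2) * (1 - (verblunsky μ 1).re))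

/-- `c₊ = 1 / √(2 (1 - α₀))`. -/
def cPlus (μ : Measure Circle) : ℝ :=
  1 / Real.sqrt (2 * (1 - (verblunsky μ 0).re))

/-- `c₋ = 1 / √(2 (1 + α₀))`. -/
def cMinus (μ : Measure Circle) : ℝ :=
  1 / Real.sqrt (2 * (1 + (verblunsky μ 0).re))

/-- The Szegő mappings. For conjugation-invariant `μ` the Verblunsky coefficients are real, so
the real parts in the constants are the coefficients themselves. -/
def szego (μ : Measure Circle) : SzegoType → Measure ℝ
  | .e => szegoE μ
  | .o => (szegoE μ).withDensity (fun x => ENNReal.ofReal (cO μ ^ 2 * (4 - x ^ 2)))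
  | .plus => (szegoE μ).withDensity (fun x => ENNReal.ofReal (cPlus μ ^ 2 * (2 - x)))
  | .minus => (szegoE μ).withDensity (fun x => ENNReal.ofReal (cMinus μ ^ 2 * (2 + x)))

/-! ### Measures on the line: orthogonal polynomials, Jacobi parameters, `m`-function -/

/-- The monic orthogonal polynomials `P_n` of a measure on the line (Gram-Schmidt procedure,
without normalization, applied to `1, x, x², …` in `L²(ν)`). -/
def lineOP (ν : Measure ℝ) : ℕ → ℝ[X]
  | n => X ^ n - ∑ k : Fin n,
      C ((∫ x : ℝ, (lineOP ν k).eval x * x ^ n ∂ν) /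
        (∫ x : ℝ, (lineOP ν k).eval x ^ 2 ∂ν)) * lineOP ν k
termination_by n => n
decreasing_by all_goals exact k.2

/-- The off-diagonal Jacobi parameters `a_n = ‖P_n‖ / ‖P_{n-1}‖` for `n ≥ 1`,
with the convention `a_0 = 1`. -/
def jacobiA (ν : Measure ℝ) : ℕ → ℝ
  | 0 => 1
  | n + 1 => Real.sqrt (∫ x, (lineOP ν (n + 1)).eval x ^ 2 ∂ν) /
      Real.sqrt (∫ x, (lineOP ν n).eval x ^ 2 ∂ν)

/-- The diagonal Jacobi parameters: `jacobiB ν n` is `b_{n+1} = ⟨x P_n, P_n⟩ / ‖P_n‖²`. -/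
def jacobiB (ν : Measure ℝ) (n : ℕ) : ℝ :=
  (∫ x, x * (lineOP ν n).eval x ^ 2 ∂ν) / (∫ x, (lineOP ν n).eval x ^ 2 ∂ν)

/-- `secondKindShift ν n` is `Q_{n-1}`, where `Q_{-1} = -1`, `Q_0 = 0` and
`Q_{n+1} = (x - b_{n+1}) Q_n - a_n² Q_{n-1}` for `n ≥ 0`. -/
def secondKindShift (ν : Measure ℝ) : ℕ → ℝ[X]
  | 0 => -1
  | 1 => 0
  | n + 2 => (X - C (jacobiB ν n)) * secondKindShift ν (n + 1) -
      C (jacobiA ν n ^ 2) * secondKindShift ν n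

/-- The second-kind polynomials `Q_n`. -/
def secondKind (ν : Measure ℝ) (n : ℕ) : ℝ[X] := secondKindShift ν (n + 1)

/-- The integral defining `m(x)` converges absolutely, `∫ dν(t) / |t - x| < ∞`
(here `1 / 0 = ∞`, so an atom at `x` is excluded). -/
def MFinite (ν : Measure ℝ) (x : ℝ) : Prop :=
  ∫⁻ t, (ENNReal.ofReal |t - x|)⁻¹ ∂ν < ⊤

/-- `m(x) = ∫ dν(t) / (t - x)` (meaningful when `MFinite ν x`). -/
def mFun (ν : Measure ℝ) (x : ℝ) : ℝ := ∫ t, 1 / (t - x) ∂ν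

/-- `P_n(x)`. -/
def P (ν : Measure ℝ) (n : ℕ) (x : ℝ) : ℝ := (lineOP ν n).eval x

/-- `F_n(x) = m(x) P_n(x) + Q_n(x)` (meaningful when `MFinite ν x`). -/
def F (ν : Measure ℝ) (n : ℕ) (x : ℝ) : ℝ := mFun ν x * P ν n x + (secondKind ν n).eval x

def ratioA (ν : Measure ℝ) (n : ℕ) : ℝ := -(P ν (n + 1) (-2) / P ν n (-2))

def ratioB (ν : Measure ℝ) (n : ℕ) : ℝ := P ν (n + 1) 2 / P ν n 2

def ratioC (ν : Measure ℝ) (n : ℕ) : ℝ := -(F ν (n + 1) (-2) / F ν n (-2))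

def ratioD (ν : Measure ℝ) (n : ℕ) : ℝ := F ν (n + 1) 2 / F ν n 2

end

end InverseGeronimus

open InverseGeronimus

namespace InverseGeronimus

noncomputable section

/-! ### Gram-Schmidt for positive definite forms on polynomials -/

/-! All four cases come down to solving `x = (1 + u)(1 - v)`, `y = (1 - u)(1 - v)` for `u` and `v`
(`solve_ratios`). What has to be shown is that each pair of ratios factors in this way through two
consecutive Verblunsky coefficients.

For (e), Szegő's identity `szegoPoly_eq` is evaluated at the self-inverse points `z = ±1`, where `z
+ 1/z = ±2`. There the Szegő recurrence becomes a scalar recursion, which gives the ratios of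
`P_n(±2)`. Comparing the three-term recurrence at `2` and at `-2` then eliminates `b` and yields
`a_{n+1}²` (`normRatio_szegoE`).

The other measures arise by multiplying with a linear weight `k (t - x)`, `x = ±2`, once for (+) and
(-) and twice for (o). Such a Christoffel step has explicit orthogonal polynomials, which gives
ratios at the other edge (`evalRatio_edgeMeasure`) and norm ratios (`normRatio_edgeMeasure`). At `x`
itself the weight cancels the kernel of `F_n(x) = ∫ P_n(t) / (t - x)`, so the new `F_n(x)` is `k
‖P_n‖² / P_n(x)` in terms of the old measure (`F_edgeMeasure_mul`), provided that `x` is not an atom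
of the latter.

Nonvanishing rests on the constant sign of `t - x` on `[-2, 2]` (`P_ne_zero`, `F_ne_zero`).
Conjugation invariance serves to identify the complex `Φ_n` with the real polynomials orthogonal for
`∫ Re (f \bar g) dμ` (`circleOP_eq`). -/

/-- A symmetric positive definite bilinear form on real polynomials. -/
structure PosDefForm (B : LinearMap.BilinForm ℝ ℝ[X]) : Prop where
  symm : ∀ f g, B f g = B g f
  pos : ∀ f, f ≠ 0 → 0 < B f f

/-- The monic orthogonal polynomials of a bilinear form. -/
def gramSchmidtPoly (B : LinearMap.BilinForm ℝ ℝ[X]) : ℕ → ℝ[X]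
  | n => X ^ n - ∑ k : Fin n,
      C (B (gramSchmidtPoly B k) (X ^ n) / B (gramSchmidtPoly B k) (gramSchmidtPoly B k)) *
        gramSchmidtPoly B k
termination_by n => n
decreasing_by all_goals exact k.2

lemma degree_C_mul_le_degree (c : ℝ) (p : ℝ[X]) : (C c * p).degree ≤ p.degree := by
  rw [← smul_eq_C_mul]; exact degree_smul_le c p

lemma degree_lt_of_monic_sub {p q : ℝ[X]} {n : ℕ} (hp : p.Monic) (hq : q.Monic)
    (hpn : p.natDegree = n) (hqn : q.natDegree = n) : (p - q).degree < n := by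
  have hpd : p.degree = n := by rw [degree_eq_natDegree hp.ne_zero, hpn]
  have hqd : q.degree = n := by rw [degree_eq_natDegree hq.ne_zero, hqn]
  have := degree_sub_lt_left (p := p) (q := q) (by rw [hpd, hqd]) hp.ne_zero
    (by rw [hp.leadingCoeff, hq.leadingCoeff])
  rwa [hpd] at this

lemma degree_quotient_lt {p q : ℝ[X]} {c x : ℝ} {n : ℕ} (h : p = C c + (X - C x) * q)
    (hp : p.degree ≤ n) : q.degree < n := by
  by_cases hq0 : q = 0
  · rw [hq0, degree_zero]; exact WithBot.bot_lt_coe n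
  have h3 : (p - C c).degree ≤ n :=
    (degree_sub_le _ _).trans (max_le hp (degree_C_le.trans (by exact_mod_cast n.zero_le)))
  rw [h, add_sub_cancel_left, degree_mul, degree_X_sub_C, degree_eq_natDegree hq0] at h3
  rw [degree_eq_natDegree hq0]
  have h5 : 1 + q.natDegree ≤ n := by exact_mod_cast h3
  exact_mod_cast (by omega : q.natDegree < n)

variable {B : LinearMap.BilinForm ℝ ℝ[X]}

lemma gramSchmidtPoly_monic_natDegree (B : LinearMap.BilinForm ℝ ℝ[X]) (n : ℕ) :
    (gramSchmidtPoly B n).Monic ∧ (gramSchmidtPoly B n).natDegree = n := by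
  induction n using Nat.strong_induction_on with
  | _ n ih =>
    rw [gramSchmidtPoly]
    set S := ∑ k : Fin n,
      C (B (gramSchmidtPoly B k) (X ^ n) / B (gramSchmidtPoly B k) (gramSchmidtPoly B k)) *
        gramSchmidtPoly B k with hS
    have hdeg : S.degree < n := by
      rw [hS, ← Polynomial.mem_degreeLT]
      refine Submodule.sum_mem _ fun k _ => ?_
      rw [Polynomial.mem_degreeLT]
      refine (degree_C_mul_le_degree _ _).trans_lt ?_
      rw [degree_eq_natDegree (ih k k.2).1.ne_zero, (ih k k.2).2]
      exact_mod_cast k.2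
    refine ⟨monic_X_pow_sub hdeg, ?_⟩
    refine natDegree_eq_of_degree_eq_some ?_
    rw [degree_sub_eq_left_of_degree_lt] <;> simp [hdeg]

lemma gramSchmidtPoly_monic (B : LinearMap.BilinForm ℝ ℝ[X]) (n : ℕ) :
    (gramSchmidtPoly B n).Monic := (gramSchmidtPoly_monic_natDegree B n).1

@[simp] lemma gramSchmidtPoly_natDegree (B : LinearMap.BilinForm ℝ ℝ[X]) (n : ℕ) :
    (gramSchmidtPoly B n).natDegree = n := (gramSchmidtPoly_monic_natDegree B n).2

lemma gramSchmidtPoly_zero (B : LinearMap.BilinForm ℝ ℝ[X]) : gramSchmidtPoly B 0 = 1 := by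
  rw [gramSchmidtPoly]; simp

lemma gramSchmidtPoly_degree (B : LinearMap.BilinForm ℝ ℝ[X]) (n : ℕ) :
    (gramSchmidtPoly B n).degree = n := by
  rw [degree_eq_natDegree (gramSchmidtPoly_monic B n).ne_zero, gramSchmidtPoly_natDegree]

/-- A polynomial of degree less than `n` that is orthogonal to `1, …, X ^ (n - 1)` vanishes on
all of the polynomials of degree less than `n`. -/
lemma form_eq_zero_of_degree_lt {f g : ℝ[X]} {n : ℕ}
    (h : ∀ k < n, B f (X ^ k) = 0) (hg : g.degree < n) : B f g = 0 := by
  rw [g.as_sum_support_C_mul_X_pow]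
  simp only [map_sum, ← smul_eq_C_mul, map_smul]
  refine Finset.sum_eq_zero fun k hk => ?_
  have hk' : (k : WithBot ℕ) < n := (le_degree_of_mem_supp k hk).trans_lt hg
  rw [h k (by exact_mod_cast hk'), smul_zero]

lemma gramSchmidtPoly_orthogonal_aux (hB : PosDefForm B) (n : ℕ) :
    ∀ j < n, B (gramSchmidtPoly B n) (gramSchmidtPoly B j) = 0 := by
  induction n using Nat.strong_induction_on with
  | _ n ih =>
    intro j hj
    rw [gramSchmidtPoly]
    simp only [map_sub, map_sum, ← smul_eq_C_mul, map_smul, LinearMap.sub_apply,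
      LinearMap.sum_apply, LinearMap.smul_apply]
    rw [Finset.sum_eq_single (⟨j, hj⟩ : Fin n)]
    · have := (hB.pos _ (gramSchmidtPoly_monic B j).ne_zero).ne'
      rw [smul_eq_mul, div_mul_cancel₀ _ this, hB.symm, sub_self]
    · rintro ⟨k, hk⟩ - hne
      have hkj : k ≠ j := fun h => hne (by simp [h])
      rcases lt_or_gt_of_ne hkj with h | h
      · rw [hB.symm (gramSchmidtPoly B k) (gramSchmidtPoly B j), ih j hj k h, smul_zero]
      · rw [ih k hk j h, smul_zero]
    · simp

/-- A polynomial orthogonal to the first `n` orthogonal polynomials is orthogonal to everything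
of degree less than `n`. -/
lemma form_eq_zero_of_forall_gramSchmidtPoly {f g : ℝ[X]} {n : ℕ}
    (h : ∀ k < n, B f (gramSchmidtPoly B k) = 0) (hg : g.degree < n) : B f g = 0 := by
  refine form_eq_zero_of_degree_lt (n := n) (fun k => ?_) hg
  induction k using Nat.strong_induction_on with
  | _ k ih =>
    intro hk
    have hX : (X ^ k : ℝ[X]) = gramSchmidtPoly B k + (X ^ k - gramSchmidtPoly B k) := by ring
    rw [hX, map_add, h k hk, zero_add]
    exact form_eq_zero_of_degree_lt (n := k) (fun j hj => ih j hj (hj.trans hk))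
      (degree_lt_of_monic_sub (monic_X_pow k) (gramSchmidtPoly_monic B k) (natDegree_X_pow k)
        (gramSchmidtPoly_natDegree B k))

/-- `gramSchmidtPoly B n` is orthogonal to all polynomials of lower degree. -/
lemma gramSchmidtPoly_orthogonal (hB : PosDefForm B) {n : ℕ} {g : ℝ[X]} (hg : g.degree < n) :
    B (gramSchmidtPoly B n) g = 0 :=
  form_eq_zero_of_forall_gramSchmidtPoly (gramSchmidtPoly_orthogonal_aux hB n) hg

/-- A monic polynomial of degree `n` orthogonal to lower degrees is `gramSchmidtPoly B n`. -/
lemma eq_gramSchmidtPoly (hB : PosDefForm B) {n : ℕ} {p : ℝ[X]} (hp : p.Monic)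
    (hn : p.natDegree = n) (h : ∀ g : ℝ[X], g.degree < n → B p g = 0) :
    p = gramSchmidtPoly B n := by
  by_contra hne
  have hd := degree_lt_of_monic_sub hp (gramSchmidtPoly_monic B n) hn (gramSchmidtPoly_natDegree B n)
  have h0 := hB.pos _ (sub_ne_zero.2 hne)
  have h1 : ∀ g, B (p - gramSchmidtPoly B n) g = B p g - B (gramSchmidtPoly B n) g := fun g => by
    rw [map_sub, LinearMap.sub_apply]
  rw [h1, h _ hd, gramSchmidtPoly_orthogonal hB hd, sub_zero] at h0
  exact lt_irrefl _ h0

/-- The squared norm of the `n`-th monic orthogonal polynomial. -/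
def gramNormSq (B : LinearMap.BilinForm ℝ ℝ[X]) (n : ℕ) : ℝ :=
  B (gramSchmidtPoly B n) (gramSchmidtPoly B n)

lemma form_gramSchmidtPoly_monic (hB : PosDefForm B) {n : ℕ} {p : ℝ[X]} (hp : p.Monic)
    (hn : p.natDegree = n) : B (gramSchmidtPoly B n) p = gramNormSq B n := by
  have hd := degree_lt_of_monic_sub hp (gramSchmidtPoly_monic B n) hn (gramSchmidtPoly_natDegree B n)
  have := gramSchmidtPoly_orthogonal hB hd
  rw [map_sub] at this
  rw [gramNormSq]
  linarith

/-! ### Positive definite functionals -/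

/-- The bilinear form `(f, g) ↦ L (f g)` of a linear functional. -/
def functionalForm (L : ℝ[X] →ₗ[ℝ] ℝ) : LinearMap.BilinForm ℝ ℝ[X] :=
  (LinearMap.mul ℝ ℝ[X]).compr₂ L

@[simp] lemma functionalForm_apply (L : ℝ[X] →ₗ[ℝ] ℝ) (f g : ℝ[X]) :
    functionalForm L f g = L (f * g) := rfl

lemma posDefForm_functionalForm {L : ℝ[X] →ₗ[ℝ] ℝ} (hL : ∀ f, f ≠ 0 → 0 < L (f * f)) :
    PosDefForm (functionalForm L) :=
  ⟨fun f g => by simp [mul_comm], fun f hf => hL f hf⟩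

/-- The monic orthogonal polynomials of a functional. -/
def functionalOP (L : ℝ[X] →ₗ[ℝ] ℝ) (n : ℕ) : ℝ[X] := gramSchmidtPoly (functionalForm L) n

/-- The squared norms of the monic orthogonal polynomials of a functional. -/
def functionalNormSq (L : ℝ[X] →ₗ[ℝ] ℝ) (n : ℕ) : ℝ := L (functionalOP L n * functionalOP L n)

variable {L : ℝ[X] →ₗ[ℝ] ℝ}

lemma functionalOP_monic (L : ℝ[X] →ₗ[ℝ] ℝ) (n : ℕ) : (functionalOP L n).Monic :=
  gramSchmidtPoly_monic _ n

@[simp] lemma functionalOP_natDegree (L : ℝ[X] →ₗ[ℝ] ℝ) (n : ℕ) :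
    (functionalOP L n).natDegree = n := gramSchmidtPoly_natDegree _ n

lemma functionalOP_degree (L : ℝ[X] →ₗ[ℝ] ℝ) (n : ℕ) : (functionalOP L n).degree = n :=
  gramSchmidtPoly_degree _ n

@[simp] lemma functionalOP_zero (L : ℝ[X] →ₗ[ℝ] ℝ) : functionalOP L 0 = 1 :=
  gramSchmidtPoly_zero _

lemma functionalNormSq_pos (hL : ∀ f, f ≠ 0 → 0 < L (f * f)) (n : ℕ) :
    0 < functionalNormSq L n := hL _ (functionalOP_monic L n).ne_zero

lemma functionalOP_orthogonal (hL : ∀ f, f ≠ 0 → 0 < L (f * f)) {n : ℕ} {g : ℝ[X]}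
    (hg : g.degree < n) : L (functionalOP L n * g) = 0 :=
  gramSchmidtPoly_orthogonal (posDefForm_functionalForm hL) hg

lemma functional_functionalOP_mul_monic (hL : ∀ f, f ≠ 0 → 0 < L (f * f)) {n : ℕ} {p : ℝ[X]}
    (hp : p.Monic) (hn : p.natDegree = n) : L (functionalOP L n * p) = functionalNormSq L n :=
  form_gramSchmidtPoly_monic (posDefForm_functionalForm hL) hp hn

lemma eq_functionalOP (hL : ∀ f, f ≠ 0 → 0 < L (f * f)) {n : ℕ} {p : ℝ[X]} (hp : p.Monic)
    (hn : p.natDegree = n) (h : ∀ g : ℝ[X], g.degree < n → L (p * g) = 0) :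
    p = functionalOP L n :=
  eq_gramSchmidtPoly (posDefForm_functionalForm hL) hp hn h

/-- The diagonal Jacobi parameters of a functional. -/
def functionalB (L : ℝ[X] →ₗ[ℝ] ℝ) (n : ℕ) : ℝ :=
  L (X * (functionalOP L n * functionalOP L n)) / functionalNormSq L n

lemma degree_X_mul_functionalOP_sub_lt (L : ℝ[X] →ₗ[ℝ] ℝ) (n : ℕ) :
    (X * functionalOP L n - functionalOP L (n + 1)).degree < ((n + 1 : ℕ) : WithBot ℕ) := by
  refine degree_lt_of_monic_sub (monic_X.mul (functionalOP_monic L n)) (functionalOP_monic L _)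
    ?_ (functionalOP_natDegree L _)
  rw [monic_X.natDegree_mul (functionalOP_monic L n)]
  simp [add_comm]

/-- A polynomial of degree less than `n` orthogonal to all such polynomials is zero. -/
lemma eq_zero_of_orthogonal (hB : PosDefForm B) {n : ℕ} {D : ℝ[X]} (hd : D.degree < n)
    (h : ∀ g : ℝ[X], g.degree < n → B D g = 0) : D = 0 := by
  by_contra hne
  exact (hB.pos D hne).ne' (h D hd)

/-- The start of the three-term recurrence, separate because `functionalOP_add_two` needs two
predecessors. -/
lemma functionalOP_one (hL : ∀ f, f ≠ 0 → 0 < L (f * f)) :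
    functionalOP L 1 = X - C (functionalB L 0) := by
  symm
  refine eq_functionalOP hL (monic_X_sub_C _) (natDegree_X_sub_C _) fun g hg => ?_
  obtain ⟨c, rfl⟩ : ∃ c, g = C c := ⟨_, eq_C_of_degree_le_zero
    (Order.lt_succ_iff.1 hg)⟩
  have h1 : L 1 ≠ 0 := by simpa using (hL 1 one_ne_zero).ne'
  have : (X - C (functionalB L 0)) * C c = c • X - (c * functionalB L 0) • (1 : ℝ[X]) := by
    simp only [smul_eq_C_mul, map_mul]; ring
  rw [this, map_sub, map_smul, map_smul, functionalB, functionalNormSq]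
  simp only [functionalOP_zero, mul_one, smul_eq_mul]
  field_simp
  ring

/-- The three-term recurrence. -/
lemma functionalOP_add_two (hL : ∀ f, f ≠ 0 → 0 < L (f * f)) (n : ℕ) :
    functionalOP L (n + 2) = (X - C (functionalB L (n + 1))) * functionalOP L (n + 1) -
      C (functionalNormSq L (n + 1) / functionalNormSq L n) * functionalOP L n := by
  set p := functionalOP L with hp
  set b := functionalB L (n + 1) with hb
  set w := functionalNormSq L (n + 1) / functionalNormSq L n with hw
  have hn0 := (functionalNormSq_pos hL n).ne'
  have hn1 := (functionalNormSq_pos hL (n + 1)).ne'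
  -- The defect of the recurrence. It has degree below `n + 2` and is orthogonal to `p k` for all `k
  -- < n + 2`: degrees settle `k < n`, the choice of `w` settles `k = n`, and that of `b` settles `k
  -- = n + 1`.
  set D : ℝ[X] := X * p (n + 1) - p (n + 2) - C b * p (n + 1) - C w * p n with hD
  have e : ∀ g, L (D * g) = L (p (n + 1) * (X * g)) - L (p (n + 2) * g)
      - b * L (p (n + 1) * g) - w * L (p n * g) := fun g => by
    have : D * g = p (n + 1) * (X * g) - p (n + 2) * g - b • (p (n + 1) * g) - w • (p n * g) := by
      rw [hD]; simp only [smul_eq_C_mul]; ring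
    rw [this]; simp
  have horth : ∀ k < n + 2, functionalForm L D (p k) = 0 := by
    intro k hk
    have hdk : ∀ m, k < m → L (p m * p k) = 0 := fun m hm =>
      functionalOP_orthogonal hL (by rw [functionalOP_degree]; exact_mod_cast hm)
    rw [functionalForm_apply, e, hdk (n + 2) hk, sub_zero]
    rcases lt_trichotomy k n with h | rfl | h
    · rw [hdk _ h, hdk (n + 1) (by omega), functionalOP_orthogonal hL]
      · simp
      · rw [degree_mul, degree_X, functionalOP_degree]
        exact_mod_cast (by omega : 1 + k < n + 1)
    · rw [hdk (k + 1) (by omega), functional_functionalOP_mul_monic hL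
        (monic_X.mul (functionalOP_monic L k))]
      · change functionalNormSq L (k + 1) - b * 0 - w * functionalNormSq L k = 0
        rw [hw]; field_simp; ring
      · rw [monic_X.natDegree_mul (functionalOP_monic L k)]
        simp [add_comm]
    · obtain rfl : k = n + 1 := by omega
      have h2 : L (p n * p (n + 1)) = 0 := by
        rw [mul_comm]
        exact functionalOP_orthogonal hL (by
          rw [functionalOP_degree]; exact_mod_cast Nat.lt_succ_self n)
      have h3 : p (n + 1) * (X * p (n + 1)) = X * (p (n + 1) * p (n + 1)) := by ring
      rw [h2, h3]
      change _ - b * functionalNormSq L (n + 1) - _ = 0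
      rw [hb, functionalB, div_mul_cancel₀ _ hn1]
      simp [hp]
  have hdeg : D.degree < ((n + 2 : ℕ) : WithBot ℕ) := by
    have h1 := degree_X_mul_functionalOP_sub_lt L (n + 1)
    rw [hD]
    refine (degree_sub_le _ _).trans_lt (max_lt ((degree_sub_le _ _).trans_lt (max_lt h1 ?_)) ?_)
    · refine (degree_C_mul_le_degree _ _).trans_lt ?_
      rw [functionalOP_degree]; exact_mod_cast (by omega)
    · refine (degree_C_mul_le_degree _ _).trans_lt ?_
      rw [functionalOP_degree]; exact_mod_cast (by omega)
  have hD0 : D = 0 := by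
    refine eq_zero_of_orthogonal (posDefForm_functionalForm hL) hdeg fun g hg => ?_
    exact form_eq_zero_of_forall_gramSchmidtPoly horth hg
  have : p (n + 2) = (X - C b) * p (n + 1) - C w * p n - D := by rw [hD]; ring
  rw [this, hD0, sub_zero]

/-! ### The Christoffel transformation -/

/-- The functional `p ↦ L (k (X - x₀) p)`. -/
def christoffel (L : ℝ[X] →ₗ[ℝ] ℝ) (k x₀ : ℝ) : ℝ[X] →ₗ[ℝ] ℝ :=
  L ∘ₗ LinearMap.mulLeft ℝ (C k * (X - C x₀))

lemma christoffel_apply (L : ℝ[X] →ₗ[ℝ] ℝ) (k x₀ : ℝ) (p : ℝ[X]) :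
    christoffel L k x₀ p = k * L ((X - C x₀) * p) := by
  rw [christoffel, LinearMap.comp_apply, LinearMap.mulLeft_apply, mul_assoc, ← smul_eq_C_mul,
    map_smul, smul_eq_mul]

/-- The right side vanishes at `x₀`, so `X - x₀` divides it. The quotient is monic of degree `n`,
and its weighted orthogonality is the orthogonality of `p_{n+1}` and `p_n` to lower degrees under
`L`. -/
lemma functionalOP_christoffel {k x₀ : ℝ} (hL : ∀ f, f ≠ 0 → 0 < L (f * f))
    (hL' : ∀ f, f ≠ 0 → 0 < christoffel L k x₀ (f * f)) (n : ℕ) (h0 : (functionalOP L n).eval x₀ ≠ 0) :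
    (X - C x₀) * functionalOP (christoffel L k x₀) n = functionalOP L (n + 1) -
      C ((functionalOP L (n + 1)).eval x₀ / (functionalOP L n).eval x₀) * functionalOP L n := by
  set β := (functionalOP L (n + 1)).eval x₀ / (functionalOP L n).eval x₀ with hβ
  set R := functionalOP L (n + 1) - C β * functionalOP L n with hR
  have hroot : R.IsRoot x₀ := by
    simp only [IsRoot.def, hR, eval_sub, eval_mul, eval_C, hβ]
    field_simp
    ring
  have hlt : (C β * functionalOP L n).degree < (functionalOP L (n + 1)).degree := by
    refine (degree_C_mul_le_degree _ _).trans_lt ?_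
    rw [functionalOP_degree, functionalOP_degree]; exact_mod_cast Nat.lt_succ_self n
  have hRm : R.Monic := by
    rw [hR, sub_eq_add_neg]
    exact (functionalOP_monic L _).add_of_left (by rwa [degree_neg])
  have hRd : R.natDegree = n + 1 := by
    refine natDegree_eq_of_degree_eq_some ?_
    rw [hR, degree_sub_eq_left_of_degree_lt hlt, functionalOP_degree]
  obtain ⟨q, hq⟩ := dvd_iff_isRoot.2 hroot
  have hqm : q.Monic := (monic_X_sub_C x₀).of_mul_monic_left (by rwa [← hq])
  have hqd : q.natDegree = n := by
    have := congrArg natDegree hq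
    rw [(monic_X_sub_C x₀).natDegree_mul hqm, natDegree_X_sub_C, hRd] at this
    omega
  have : q = functionalOP (christoffel L k x₀) n := by
    refine eq_functionalOP hL' hqm hqd fun g hg => ?_
    rw [christoffel_apply, ← mul_assoc, ← hq, hR, sub_mul, map_sub, functionalOP_orthogonal hL
      (hg.trans (by exact_mod_cast Nat.lt_succ_self n)), mul_assoc, ← smul_eq_C_mul, map_smul,
      functionalOP_orthogonal hL hg]
    simp
  rw [← this, ← hq]

/-- Pairing the Christoffel identity with the new polynomial kills the `p_{n+1}` term by degree. -/
lemma functionalNormSq_christoffel {k x₀ : ℝ} (hL : ∀ f, f ≠ 0 → 0 < L (f * f))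
    (hL' : ∀ f, f ≠ 0 → 0 < christoffel L k x₀ (f * f)) (n : ℕ) (h0 : (functionalOP L n).eval x₀ ≠ 0) :
    functionalNormSq (christoffel L k x₀) n =
      -k * ((functionalOP L (n + 1)).eval x₀ / (functionalOP L n).eval x₀) *
        functionalNormSq L n := by
  set q := functionalOP (christoffel L k x₀) n with hq
  have hd : q.degree < ((n + 1 : ℕ) : WithBot ℕ) := by
    rw [hq, functionalOP_degree]; exact_mod_cast Nat.lt_succ_self n
  rw [functionalNormSq, ← hq, christoffel_apply, ← mul_assoc,
    functionalOP_christoffel hL hL' n h0, sub_mul, map_sub, functionalOP_orthogonal hL hd,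
    mul_assoc, ← smul_eq_C_mul, map_smul, functional_functionalOP_mul_monic hL
    (functionalOP_monic _ n) (functionalOP_natDegree _ n), smul_eq_mul]
  ring

/-- Write `p = p(x₀) + (X - x₀) r` with `deg r < n`. Weighted orthogonality of `q` to `r` gives `L
(p q) = p(x₀) L q`. The unweighted value `L q` is what remains of `F` once the weight cancels its
kernel. -/
lemma functional_functionalOP_christoffel {k x₀ : ℝ} (hL : ∀ f, f ≠ 0 → 0 < L (f * f))
    (hL' : ∀ f, f ≠ 0 → 0 < christoffel L k x₀ (f * f)) (n : ℕ) (hk : k ≠ 0) :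
    L (functionalOP (christoffel L k x₀) n) * (functionalOP L n).eval x₀ =
      functionalNormSq L n := by
  set q := functionalOP (christoffel L k x₀) n with hq
  set p := functionalOP L n with hp
  obtain ⟨r, hr⟩ := X_sub_C_dvd_sub_C_eval (p := p) (a := x₀)
  have h1 : L (p * q) = functionalNormSq L n := functional_functionalOP_mul_monic hL
    (functionalOP_monic _ n) (functionalOP_natDegree _ n)
  have h2 : christoffel L k x₀ (q * r) = 0 := by
    refine functionalOP_orthogonal hL' (degree_quotient_lt (c := p.eval x₀) (x := x₀) (p := p) ?_ ?_)
    · rw [← hr]; ring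
    · rw [hp, functionalOP_degree]
  rw [christoffel_apply] at h2
  have h3 : L ((X - C x₀) * (q * r)) = 0 := (mul_eq_zero.1 h2).resolve_left hk
  have h4 : (X - C x₀) * (q * r) = p * q - (p.eval x₀) • q := by
    rw [smul_eq_C_mul, mul_left_comm, ← hr]; ring
  rw [h4, map_sub, map_smul, h1, smul_eq_mul] at h3
  linarith

/-! ### Measures on `[-2, 2]` -/

/-- Nontrivial probability measures supported on `[-2, 2]`. -/
structure Admissible (ν : Measure ℝ) : Prop where
  prob : IsProbabilityMeasure ν
  supp : ν (Set.Icc (-2) 2)ᶜ = 0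
  nontrivial : NontrivialMeasure ν

/-- The linear functional `p ↦ ∫ p dν`, defined through the moments of `ν`. -/
def lineFunctional (ν : Measure ℝ) : ℝ[X] →ₗ[ℝ] ℝ :=
  Polynomial.lsum fun n => (∫ x, x ^ n ∂ν) • LinearMap.id

namespace Admissible

variable {ν : Measure ℝ}

lemma ae_mem (h : Admissible ν) : ∀ᵐ x ∂ν, x ∈ Set.Icc (-2 : ℝ) 2 := h.supp

lemma integrable_of_continuous (h : Admissible ν) {f : ℝ → ℝ} (hf : Continuous f) :
    Integrable f ν := by
  have := h.prob
  have := hf.continuousOn.integrableOn_compact (μ := ν) (isCompact_Icc (a := (-2 : ℝ)) (b := 2))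
  rwa [IntegrableOn, Measure.restrict_eq_self_of_ae_mem h.ae_mem] at this

lemma lineFunctional_apply (h : Admissible ν) (p : ℝ[X]) :
    lineFunctional ν p = ∫ x, p.eval x ∂ν := by
  simp only [lineFunctional, lsum_apply, eval_eq_sum, Polynomial.sum, LinearMap.smul_apply,
    LinearMap.id_apply, smul_eq_mul]
  rw [integral_finsetSum _ fun i _ => h.integrable_of_continuous (by fun_prop)]
  exact Finset.sum_congr rfl fun i _ => by rw [integral_const_mul, mul_comm]

/-- If the integral were zero, `ν` would be carried by the finite set `s`, against nontriviality. -/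
lemma integral_pos (h : Admissible ν) {f : ℝ → ℝ} (hf : Integrable f ν) {s : Set ℝ}
    (hs : s.Finite) (h0 : ∀ x ∈ Set.Icc (-2 : ℝ) 2, 0 ≤ f x)
    (hpos : ∀ x ∈ Set.Icc (-2 : ℝ) 2, x ∉ s → 0 < f x) : 0 < ∫ x, f x ∂ν := by
  rw [integral_pos_iff_support_of_nonneg_ae (by
    filter_upwards [h.ae_mem] with x hx using h0 x hx) hf]
  rw [pos_iff_ne_zero]
  intro hzero
  refine h.nontrivial s hs (measure_mono_null (t := Function.support f ∪ (Set.Icc (-2 : ℝ) 2)ᶜ)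
    (fun x hx => ?_) (measure_union_null hzero h.supp))
  by_cases hI : x ∈ Set.Icc (-2 : ℝ) 2
  · exact Or.inl (hpos x hI hx).ne'
  · exact Or.inr hI

lemma lineFunctional_pos (h : Admissible ν) (f : ℝ[X]) (hf : f ≠ 0) :
    0 < lineFunctional ν (f * f) := by
  rw [h.lineFunctional_apply]
  refine h.integral_pos (h.integrable_of_continuous (Polynomial.continuous _))
    (f.roots.toFinset.finite_toSet) (fun x _ => ?_) fun x _ hx => ?_
  · rw [eval_mul]; exact mul_self_nonneg _
  · rw [eval_mul]
    have : f.eval x ≠ 0 := fun h0 => hx (by simp [hf, h0])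
    exact mul_self_pos.2 this

lemma lineOP_eq (h : Admissible ν) (n : ℕ) : lineOP ν n = functionalOP (lineFunctional ν) n := by
  induction n using Nat.strong_induction_on with
  | _ n ih =>
    rw [lineOP, functionalOP, gramSchmidtPoly]
    congr 1
    refine Finset.sum_congr rfl fun k _ => ?_
    rw [ih k k.2, functionalForm_apply, functionalForm_apply, h.lineFunctional_apply,
      h.lineFunctional_apply]
    simp only [eval_mul, eval_pow, eval_X, ← pow_two]
    rfl

lemma P_eq (h : Admissible ν) (n : ℕ) (x : ℝ) :
    P ν n x = (functionalOP (lineFunctional ν) n).eval x := by rw [P, h.lineOP_eq]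

lemma integral_sq_eq (h : Admissible ν) (n : ℕ) :
    ∫ x, (lineOP ν n).eval x ^ 2 ∂ν = functionalNormSq (lineFunctional ν) n := by
  rw [functionalNormSq, h.lineFunctional_apply, h.lineOP_eq]
  simp only [eval_mul, pow_two]

lemma normSq_pos (h : Admissible ν) (n : ℕ) : 0 < functionalNormSq (lineFunctional ν) n :=
  functionalNormSq_pos h.lineFunctional_pos n

lemma lineFunctional_one (h : Admissible ν) : lineFunctional ν 1 = 1 := by
  have := h.prob
  rw [h.lineFunctional_apply]; simp

lemma jacobiA_sq (h : Admissible ν) (n : ℕ) : jacobiA ν (n + 1) ^ 2 =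
    functionalNormSq (lineFunctional ν) (n + 1) / functionalNormSq (lineFunctional ν) n := by
  rw [jacobiA, div_pow, h.integral_sq_eq, h.integral_sq_eq, Real.sq_sqrt (h.normSq_pos _).le,
    Real.sq_sqrt (h.normSq_pos _).le]

lemma jacobiB_eq (h : Admissible ν) (n : ℕ) :
    jacobiB ν n = functionalB (lineFunctional ν) n := by
  rw [jacobiB, functionalB, h.integral_sq_eq, h.lineFunctional_apply, h.lineOP_eq]
  simp only [eval_mul, eval_X, pow_two]

/-- The second-kind polynomial is the integral of the difference quotient. -/
lemma exists_quotient (h : Admissible ν) (x : ℝ) (n : ℕ) :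
    ∃ q : ℝ[X], functionalOP (lineFunctional ν) n = C (P ν n x) + (X - C x) * q ∧
      lineFunctional ν q = (secondKind ν n).eval x := by
  induction n using Nat.strong_induction_on with
  | _ n ih =>
    match n with
    | 0 => exact ⟨0, by simp [h.P_eq], by simp [secondKind, secondKindShift]⟩
    | 1 =>
      refine ⟨1, ?_, ?_⟩
      · rw [h.P_eq, functionalOP_one h.lineFunctional_pos]
        simp
      -- `Q_1 = -a_0² Q_{-1} = 1` by the conventions `a_0 = 1`, `Q_{-1} = -1`. It matches `∫ 1 dν`
      -- because `ν` is a probability measure.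
      · simp [secondKind, secondKindShift, jacobiA, h.lineFunctional_one]
    | n + 2 =>
      obtain ⟨q, hq, hQ⟩ := ih n (by omega)
      obtain ⟨q', hq', hQ'⟩ := ih (n + 1) (by omega)
      have h3 := functionalOP_add_two h.lineFunctional_pos n
      set L := lineFunctional ν with hL
      set b := functionalB L (n + 1)
      set w := functionalNormSq L (n + 1) / functionalNormSq L n
      -- Splitting `X - b = (X - x) + (x - b)` in the recurrence gives this quotient. Its first term
      -- integrates to zero, so the integrals obey the recurrence of `Q_n`.
      refine ⟨functionalOP L (n + 1) + C (x - b) * q' - C w * q, ?_, ?_⟩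
      · have hP : P ν (n + 2) x = (x - b) * P ν (n + 1) x - w * P ν n x := by
          rw [h.P_eq, h3]; simp [h.P_eq, hL]
        rw [hP, h3]
        simp only [C_sub, C_mul]
        linear_combination (C x - C b) * hq' - C w * hq
      · have h0 : L (functionalOP L (n + 1)) = 0 := by
          have := functionalOP_orthogonal h.lineFunctional_pos (n := n + 1) (g := 1)
            (by rw [degree_one]; exact_mod_cast n.succ_pos)
          rwa [mul_one] at this
        rw [map_sub, map_add, h0, ← smul_eq_C_mul, ← smul_eq_C_mul, map_smul, map_smul, hQ, hQ']
        rw [show secondKind ν (n + 2) = (X - C (jacobiB ν (n + 1))) * secondKind ν (n + 1) -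
          C (jacobiA ν (n + 1) ^ 2) * secondKind ν n from rfl, h.jacobiB_eq, h.jacobiA_sq]
        simp [b, w, hL]

end Admissible

/-! ### Finiteness of `m(x)` and the integral form of `F_n(x)` -/

variable {ν : Measure ℝ}

/-- The integrand is `0⁻¹ = ⊤` at `t = x`, so an atom there would make the integral infinite. -/
lemma MFinite.measure_singleton {x : ℝ} (hm : MFinite ν x) : ν {x} = 0 := by
  by_contra hne
  refine hm.ne (top_le_iff.1 ?_)
  calc (⊤ : ENNReal) = ∫⁻ t in {x}, (ENNReal.ofReal |t - x|)⁻¹ ∂ν := by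
        rw [lintegral_singleton]; simp [ENNReal.top_mul hne]
    _ ≤ _ := setLIntegral_le_lintegral _ _

lemma MFinite.integrable {x : ℝ} (hm : MFinite ν x) : Integrable (fun t => 1 / (t - x)) ν := by
  refine ⟨(by fun_prop : Measurable fun t : ℝ => 1 / (t - x)).aestronglyMeasurable, ?_⟩
  refine lt_of_le_of_lt (lintegral_mono fun t => ?_) hm
  rw [← ofReal_norm, norm_div, norm_one, Real.norm_eq_abs, one_div]
  -- Only an inequality: at `t = x` the real inverse is `0` while the extended one is `⊤`.
  exact ENNReal.ofReal_inv_le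

lemma ae_ne_of_measure_singleton {x : ℝ} (h : ν {x} = 0) : ∀ᵐ t ∂ν, t ≠ x := by
  rw [ae_iff]; simpa using h

namespace Admissible

lemma integral_div (h : Admissible ν) {x : ℝ} (hm : MFinite ν x) {p q : ℝ[X]} {c : ℝ}
    (hp : p = C c + (X - C x) * q) :
    Integrable (fun t => p.eval t / (t - x)) ν ∧
      ∫ t, p.eval t / (t - x) ∂ν = mFun ν x * c + lineFunctional ν q := by
  have hae : (fun t => p.eval t / (t - x)) =ᵐ[ν] fun t => c * (1 / (t - x)) + q.eval t := by
    filter_upwards [ae_ne_of_measure_singleton hm.measure_singleton] with t ht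
    have : t - x ≠ 0 := sub_ne_zero.2 ht
    rw [hp]
    simp only [eval_add, eval_mul, eval_sub, eval_C, eval_X]
    field_simp
  have h1 := hm.integrable.const_mul c
  have h2 := h.integrable_of_continuous q.continuous
  refine ⟨(h1.add h2).congr hae.symm, ?_⟩
  rw [integral_congr_ae hae, integral_add h1 h2, integral_const_mul, h.lineFunctional_apply, mFun,
    mul_comm]

lemma F_eq_integral (h : Admissible ν) {x : ℝ} (hm : MFinite ν x) (n : ℕ) :
    F ν n x = ∫ t, (lineOP ν n).eval t / (t - x) ∂ν := by
  obtain ⟨q, hq, hQ⟩ := h.exists_quotient x n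
  rw [h.lineOP_eq, (h.integral_div hm hq).2, hQ, F]

end Admissible

/-! ### Nonvanishing of `P_n` and `F_n` at the end points -/

/-- `x` is an end point of `[-2, 2]`, and `k (t - x)` is positive on the rest of the interval. -/
def IsEdge (k x : ℝ) : Prop := ∀ t ∈ Set.Icc (-2 : ℝ) 2, t ≠ x → 0 < k * (t - x)

lemma isEdge_two {k : ℝ} (hk : k < 0) : IsEdge k 2 := fun _ ht hne =>
  mul_pos_of_neg_of_neg hk (sub_neg.2 (lt_of_le_of_ne ht.2 hne))

lemma isEdge_neg_two {k : ℝ} (hk : 0 < k) : IsEdge k (-2) := fun _ ht hne =>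
  mul_pos hk (sub_pos.2 (lt_of_le_of_ne ht.1 hne.symm))

lemma IsEdge.nonneg {k x : ℝ} (hx : IsEdge k x) {t : ℝ} (ht : t ∈ Set.Icc (-2 : ℝ) 2) :
    0 ≤ k * (t - x) := by
  by_cases h : t = x
  · simp [h]
  · exact (hx t ht h).le

lemma IsEdge.ne_zero {k x : ℝ} (hx : IsEdge k x) : k ≠ 0 := by
  rintro rfl
  by_cases h : x = 0
  · simpa using hx 1 (by norm_num) (by simp [h])
  · simpa using hx 0 (by norm_num) (Ne.symm h)

namespace Admissible

lemma christoffel_pos (h : Admissible ν) {k x : ℝ} (hx : IsEdge k x) (f : ℝ[X]) (hf : f ≠ 0) :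
    0 < christoffel (lineFunctional ν) k x (f * f) := by
  rw [christoffel_apply, h.lineFunctional_apply, ← integral_const_mul]
  have e : ∀ t, k * ((X - C x) * (f * f)).eval t = k * (t - x) * (f.eval t * f.eval t) := by
    intro t; simp; ring
  simp only [e]
  refine h.integral_pos (h.integrable_of_continuous (by fun_prop))
    (s := insert x f.roots.toFinset) (Set.Finite.insert _ (Finset.finite_toSet _))
    (fun t ht => ?_) fun t ht hts => ?_
  · exact mul_nonneg (hx.nonneg ht) (mul_self_nonneg _)
  · have h1 : t ≠ x := fun h0 => hts (by simp [h0])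
    have h2 : f.eval t ≠ 0 := fun h0 => hts (by simp [hf, h0])
    exact mul_pos (hx t ht h1) (mul_self_pos.2 h2)

/-- If `P_n = (X - x) q`, orthogonality gives `∫ (t - x) q² dν = 0`, impossible since `t - x` keeps
its sign. -/
lemma P_ne_zero (h : Admissible ν) {k x : ℝ} (hx : IsEdge k x) (n : ℕ) : P ν n x ≠ 0 := by
  intro h0
  obtain ⟨q, hq, -⟩ := h.exists_quotient x n
  rw [h0, C_0, zero_add] at hq
  have hne : functionalOP (lineFunctional ν) n ≠ 0 := (functionalOP_monic _ n).ne_zero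
  have hq0 : q ≠ 0 := by rintro rfl; simp [hne] at hq
  have hd : q.degree < n := degree_quotient_lt (c := 0) (x := x) (by rwa [C_0, zero_add])
    (functionalOP_degree (lineFunctional ν) n).le
  have h1 := h.christoffel_pos hx q hq0
  rw [christoffel_apply, ← mul_assoc, ← hq, functionalOP_orthogonal h.lineFunctional_pos hd] at h1
  simp at h1

/-- `P_n(x) F_n(x) = ∫ P_n(t)² / (t - x) dν(t)`, because the difference quotient of `P_n` is
orthogonal to `P_n`; the integrand has constant sign. -/
lemma F_ne_zero (h : Admissible ν) {k x : ℝ} (hx : IsEdge k x) (hm : MFinite ν x) (n : ℕ) :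
    F ν n x ≠ 0 := by
  obtain ⟨q, hq, hQ⟩ := h.exists_quotient x n
  set p := functionalOP (lineFunctional ν) n with hp
  have hpq : lineFunctional ν (p * q) = 0 := by
    exact functionalOP_orthogonal h.lineFunctional_pos
      (degree_quotient_lt hq (functionalOP_degree _ n).le)
  have hpp : p * p = C (P ν n x * P ν n x) + (X - C x) * (C (P ν n x) * q + p * q) := by
    rw [C_mul]
    linear_combination (p + C (P ν n x)) * hq
  obtain ⟨hi, hI⟩ := h.integral_div hm hpp
  have e : ∀ t, t ≠ x →
      k * ((p * p).eval t / (t - x)) = k * (t - x) * (p.eval t / (t - x)) ^ 2 := fun t ht => by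
    have : t - x ≠ 0 := sub_ne_zero.2 ht
    rw [eval_mul]
    field_simp
  have hpos : 0 < ∫ t, k * ((p * p).eval t / (t - x)) ∂ν := by
    refine h.integral_pos (hi.const_mul k) (s := insert x p.roots.toFinset)
      (Set.Finite.insert _ (Finset.finite_toSet _)) (fun t ht => ?_) fun t ht hts => ?_
    · by_cases h1 : t = x
      · simp [h1]
      · rw [e t h1]
        exact mul_nonneg (hx.nonneg ht) (sq_nonneg _)
    · have h1 : t ≠ x := fun h0 => hts (by simp [h0])
      have h2 : p.eval t ≠ 0 := fun h0 => hts (by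
        simp [(functionalOP_monic (lineFunctional ν) n).ne_zero, hp.symm ▸ h0, hp])
      rw [e t h1]
      have := hx t ht h1
      have h3 := div_ne_zero h2 (sub_ne_zero.2 h1)
      positivity
  rw [integral_const_mul, hI, map_add, hpq, ← smul_eq_C_mul, map_smul, smul_eq_mul] at hpos
  intro h0
  have h1 : F ν n x = mFun ν x * P ν n x + lineFunctional ν q := by rw [hQ, F]
  have h2 : k * (mFun ν x * (P ν n x * P ν n x) + (P ν n x * lineFunctional ν q + 0)) =
    k * P ν n x * F ν n x := by rw [h1]; ring
  rw [h2, h0, mul_zero] at hpos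
  exact lt_irrefl _ hpos

end Admissible

/-! ### Multiplication by a linear weight -/

/-- The measure `k (t - x) dν(t)`. -/
def edgeMeasure (ν : Measure ℝ) (k x : ℝ) : Measure ℝ :=
  ν.withDensity fun t => ENNReal.ofReal (k * (t - x))

lemma measurable_edge_density (k x : ℝ) :
    Measurable fun t : ℝ => ENNReal.ofReal (k * (t - x)) := by fun_prop

namespace Admissible

variable {k x : ℝ}

lemma integral_edgeMeasure (h : Admissible ν) (hx : IsEdge k x) (f : ℝ → ℝ) :
    ∫ t, f t ∂(edgeMeasure ν k x) = ∫ t, k * (t - x) * f t ∂ν := by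
  rw [edgeMeasure, integral_withDensity_eq_integral_toReal_smul (measurable_edge_density k x)
    (Filter.Eventually.of_forall fun _ => ENNReal.ofReal_lt_top)]
  refine integral_congr_ae ?_
  filter_upwards [h.ae_mem] with t ht
  rw [ENNReal.toReal_ofReal (hx.nonneg ht), smul_eq_mul]

lemma edgeMeasure_admissible (h : Admissible ν) (hx : IsEdge k x)
    (hmass : ∫ t, k * (t - x) ∂ν = 1) : Admissible (edgeMeasure ν k x) where
  prob := by
    constructor
    rw [edgeMeasure, withDensity_apply _ MeasurableSet.univ, Measure.restrict_univ,
      ← ofReal_integral_eq_lintegral_ofReal (h.integrable_of_continuous (by fun_prop)), hmass,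
      ENNReal.ofReal_one]
    filter_upwards [h.ae_mem] with t ht using hx.nonneg ht
  supp := withDensity_absolutelyContinuous _ _ h.supp
  nontrivial s hs h0 := by
    rw [edgeMeasure, withDensity_apply_eq_zero (measurable_edge_density k x)] at h0
    -- The density vanishes at `x`, so `x` joins the exceptional set.
    refine h.nontrivial (insert x s) (hs.insert x) (measure_mono_null (fun t ht => ?_)
      (measure_union_null h0 h.supp))
    by_cases hI : t ∈ Set.Icc (-2 : ℝ) 2
    · rw [Set.mem_compl_iff, Set.mem_insert_iff, not_or] at ht
      exact Or.inl ⟨(ENNReal.ofReal_pos.2 (hx t hI ht.1)).ne', ht.2⟩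
    · exact Or.inr hI

lemma lineFunctional_edgeMeasure (h : Admissible ν) (hx : IsEdge k x)
    (h' : Admissible (edgeMeasure ν k x)) :
    lineFunctional (edgeMeasure ν k x) = christoffel (lineFunctional ν) k x := by
  refine LinearMap.ext fun p => ?_
  rw [h'.lineFunctional_apply, h.integral_edgeMeasure hx, christoffel_apply,
    h.lineFunctional_apply, ← integral_const_mul]
  refine integral_congr_ae (Filter.Eventually.of_forall fun t => ?_)
  simp only [eval_mul, eval_sub, eval_X, eval_C]
  ring

end Admissible

/-- The weight cancels the singularity and leaves an integrand bounded by `|k|`; at `t = x` this is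
`0 * ⊤ = 0`. -/
lemma mFinite_edgeMeasure [IsFiniteMeasure ν] (k x : ℝ) : MFinite (edgeMeasure ν k x) x := by
  rw [MFinite, edgeMeasure, lintegral_withDensity_eq_lintegral_mul _ (measurable_edge_density k x)
    (by fun_prop)]
  refine lt_of_le_of_lt (lintegral_mono (g := fun _ => ENNReal.ofReal |k|) fun t => ?_) ?_
  · rw [Pi.mul_apply]
    calc ENNReal.ofReal (k * (t - x)) * (ENNReal.ofReal |t - x|)⁻¹
        ≤ (ENNReal.ofReal |k| * ENNReal.ofReal |t - x|) * (ENNReal.ofReal |t - x|)⁻¹ := by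
          gcongr
          rw [← ENNReal.ofReal_mul (abs_nonneg k), ← abs_mul]
          exact ENNReal.ofReal_le_ofReal (le_abs_self _)
      _ ≤ ENNReal.ofReal |k| := by
          rw [mul_assoc]
          exact mul_le_of_le_one_right' (ENNReal.mul_inv_le_one _)
  · rw [lintegral_const]
    exact ENNReal.mul_lt_top ENNReal.ofReal_lt_top (measure_lt_top _ _)

/-! ### Ratios of values and norms under a linear weight -/

/-- The ratio of successive orthogonal polynomials. -/
def evalRatio (ν : Measure ℝ) (x : ℝ) (n : ℕ) : ℝ := P ν (n + 1) x / P ν n x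

/-- The ratio of the squared norms of successive orthogonal polynomials. -/
def normRatio (ν : Measure ℝ) (n : ℕ) : ℝ :=
  functionalNormSq (lineFunctional ν) (n + 1) / functionalNormSq (lineFunctional ν) n

namespace Admissible

variable {k x : ℝ}

lemma evalRatio_ne_zero (h : Admissible ν) (hx : IsEdge k x) (n : ℕ) : evalRatio ν x n ≠ 0 :=
  div_ne_zero (h.P_ne_zero hx _) (h.P_ne_zero hx _)

lemma evalRatio_zero (h : Admissible ν) (x : ℝ) : evalRatio ν x 0 = x - ∫ t, t ∂ν := by
  rw [evalRatio, h.P_eq, h.P_eq, functionalOP_one h.lineFunctional_pos, functionalB,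
    functionalNormSq, functionalOP_zero]
  simp [h.lineFunctional_apply, h.prob.measure_univ, Measure.real]

/-- The total mass of `k (t - x) dν(t)`. -/
lemma integral_edge (h : Admissible ν) (k x : ℝ) :
    ∫ t, k * (t - x) ∂ν = -k * evalRatio ν x 0 := by
  have := h.prob
  rw [integral_const_mul, integral_sub (h.integrable_of_continuous (f := fun t => t) continuous_id)
    (integrable_const _), h.evalRatio_zero]
  simp
  ring

lemma evalRatio_succ (h : Admissible ν) (hx : IsEdge k x) (n : ℕ) :
    evalRatio ν x (n + 1) =
      x - functionalB (lineFunctional ν) (n + 1) - normRatio ν n / evalRatio ν x n := by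
  have h0 := h.P_ne_zero hx n
  have h1 := h.P_ne_zero hx (n + 1)
  rw [evalRatio, evalRatio]
  have : P ν (n + 2) x = (x - functionalB (lineFunctional ν) (n + 1)) * P ν (n + 1) x -
      normRatio ν n * P ν n x := by
    rw [h.P_eq, functionalOP_add_two h.lineFunctional_pos]
    simp [h.P_eq, normRatio]
  rw [this]
  field_simp

/-- At `y` the Christoffel identity reads `(y - x) q_m(y) = P_m(y) (r_y(m) - r_x(m))`, with `r` the
ratios for `ν`; divide the cases `m = n + 1` and `m = n`. -/
lemma evalRatio_edgeMeasure (h : Admissible ν) (hx : IsEdge k x)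
    (h' : Admissible (edgeMeasure ν k x)) {k' y : ℝ} (hy : IsEdge k' y) (hxy : y ≠ x) (n : ℕ) :
    evalRatio (edgeMeasure ν k x) y n = evalRatio ν y n *
      (evalRatio ν y (n + 1) - evalRatio ν x (n + 1)) / (evalRatio ν y n - evalRatio ν x n) := by
  have key : ∀ m, (y - x) * P (edgeMeasure ν k x) m y =
      P ν m y * (evalRatio ν y m - evalRatio ν x m) := fun m => by
    have h0 := h.P_ne_zero hx m
    have h1 := functionalOP_christoffel h.lineFunctional_pos (fun f hf => h.christoffel_pos hx f hf)
      m (by rwa [← h.P_eq])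
    have h2 := congrArg (eval y) h1
    rw [← h.lineFunctional_edgeMeasure hx h'] at h2
    simp only [eval_mul, eval_sub, eval_X, eval_C, ← h.P_eq, ← h'.P_eq] at h2
    rw [h2, evalRatio, evalRatio]
    have h3 := h.P_ne_zero hy m
    field_simp
  have hd : y - x ≠ 0 := sub_ne_zero.2 hxy
  have h0 := h.P_ne_zero hy n
  have h1 := h.P_ne_zero hy (n + 1)
  have hq := h'.P_ne_zero hy n
  have e0 := key n
  have e1 := key (n + 1)
  -- The denominator is nonzero because `y` is an edge for the new measure too, so `q_n(y) ≠ 0`.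
  have hne : evalRatio ν y n - evalRatio ν x n ≠ 0 := fun hz => by
    rw [hz, mul_zero] at e0
    exact mul_ne_zero hd hq e0
  rw [eq_div_iff hne, evalRatio, div_mul_eq_mul_div, div_eq_iff hq]
  apply mul_left_cancel₀ hd
  have e2 : evalRatio ν y n * P ν n y = P ν (n + 1) y := div_mul_cancel₀ _ h0
  linear_combination (evalRatio ν y n - evalRatio ν x n) * e1 -
    evalRatio ν y n * (evalRatio ν y (n + 1) - evalRatio ν x (n + 1)) * e0 -
    (evalRatio ν y n - evalRatio ν x n) * (evalRatio ν y (n + 1) - evalRatio ν x (n + 1)) * e2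

lemma normRatio_edgeMeasure (h : Admissible ν) (hx : IsEdge k x)
    (h' : Admissible (edgeMeasure ν k x)) (n : ℕ) :
    normRatio (edgeMeasure ν k x) n =
      evalRatio ν x (n + 1) / evalRatio ν x n * normRatio ν n := by
  have key : ∀ m, functionalNormSq (lineFunctional (edgeMeasure ν k x)) m =
      -k * evalRatio ν x m * functionalNormSq (lineFunctional ν) m := fun m => by
    have h0 := h.P_ne_zero hx m
    have h1 := functionalNormSq_christoffel h.lineFunctional_pos
      (fun f hf => h.christoffel_pos hx f hf) m (by rwa [← h.P_eq])
    rw [← h.lineFunctional_edgeMeasure hx h'] at h1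
    rw [h1, evalRatio, h.P_eq, h.P_eq]
  have hk := hx.ne_zero
  have h0 := h.evalRatio_ne_zero hx n
  have h1 := (h.normSq_pos n).ne'
  rw [normRatio, normRatio, key, key]
  field_simp

/-- The weight cancels `1 / (t - x)` and leaves `k ∫ q_n dν`, known from
`functional_functionalOP_christoffel`. At `t = x` the product is `0` by convention instead of `k
q_n(x)`, so that point must be null. -/
lemma F_edgeMeasure_mul (h : Admissible ν) (hx : IsEdge k x)
    (h' : Admissible (edgeMeasure ν k x)) (hatom : ν {x} = 0) (n : ℕ) :
    F (edgeMeasure ν k x) n x * P ν n x = k * functionalNormSq (lineFunctional ν) n := by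
  have := h.prob
  have h1 := functional_functionalOP_christoffel h.lineFunctional_pos
    (fun f hf => h.christoffel_pos hx f hf) n hx.ne_zero
  rw [← h1, ← h.P_eq, ← mul_assoc, h'.F_eq_integral (mFinite_edgeMeasure k x),
    h.integral_edgeMeasure hx, h.lineFunctional_apply, ← integral_const_mul]
  congr 1
  refine integral_congr_ae ?_
  filter_upwards [ae_ne_of_measure_singleton hatom] with t ht
  have : t - x ≠ 0 := sub_ne_zero.2 ht
  rw [h'.lineOP_eq, h.lineFunctional_edgeMeasure hx h']
  field_simp

lemma F_ratio_edgeMeasure (h : Admissible ν) (hx : IsEdge k x)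
    (h' : Admissible (edgeMeasure ν k x)) (hatom : ν {x} = 0) (n : ℕ) :
    F (edgeMeasure ν k x) (n + 1) x / F (edgeMeasure ν k x) n x =
      normRatio ν n / evalRatio ν x n := by
  have h0 := h.P_ne_zero hx n
  have h1 := h.P_ne_zero hx (n + 1)
  have e0 := h.F_edgeMeasure_mul hx h' hatom n
  have e1 := h.F_edgeMeasure_mul hx h' hatom (n + 1)
  have hk := hx.ne_zero
  have hn := (h.normSq_pos n).ne'
  rw [eq_div_of_mul_eq h0 e0, eq_div_of_mul_eq h1 e1, normRatio, evalRatio]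
  field_simp

end Admissible

/-! ### The form of a measure on the circle -/

/-- The value of a real polynomial at a complex number. -/
def cval (f : ℝ[X]) (z : ℂ) : ℂ := eval₂ Complex.ofRealHom z f

lemma cval_add (f g : ℝ[X]) (z : ℂ) : cval (f + g) z = cval f z + cval g z := eval₂_add _ _

lemma cval_smul (c : ℝ) (f : ℝ[X]) (z : ℂ) : cval (c • f) z = c * cval f z := by
  rw [cval, eval₂_smul]; rfl

@[simp] lemma cval_X_pow (n : ℕ) (z : ℂ) : cval (X ^ n) z = z ^ n := by simp [cval]

lemma cval_X_mul (f : ℝ[X]) (z : ℂ) : cval (X * f) z = z * cval f z := by simp [cval, eval₂_mul]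

lemma conj_cval (f : ℝ[X]) (z : ℂ) :
    (starRingEnd ℂ) (cval f z) = cval f ((starRingEnd ℂ) z) := by
  rw [cval, hom_eval₂, cval]
  congr 1
  ext x
  simp

@[fun_prop] lemma continuous_cval (f : ℝ[X]) : Continuous fun z : Circle => cval f (z : ℂ) := by
  have : (fun z : Circle => cval f (z : ℂ)) =
      fun z : Circle => (f.map Complex.ofRealHom).eval (z : ℂ) := by
    funext z; rw [eval_map, cval]
  rw [this]
  exact (Polynomial.continuous _).comp continuous_subtype_val

/-- Stated over any field to serve both complex values on the circle and real values at `±1`. -/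
lemma eval₂_reflect {K : Type*} [Field K] (i : ℝ →+* K) {x y : K} (hxy : x * y = 1) {N : ℕ}
    {f : ℝ[X]} (hf : f.natDegree ≤ N) :
    eval₂ i x (reflect N f) = x ^ N * eval₂ i y f := by
  let _ : Invertible y := ⟨x, hxy, by rw [mul_comm, hxy]⟩
  have h : eval₂ i x (reflect N f) * y ^ N = eval₂ i y f := eval₂_reflect_mul_pow i y N f hf
  rw [← h, mul_comm, mul_assoc, mul_comm (y ^ N), ← mul_pow, hxy, one_pow, mul_one]

lemma Circle.mul_conj_coe (z : Circle) : (z : ℂ) * (starRingEnd ℂ) (z : ℂ) = 1 := by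
  rw [Complex.mul_conj, Circle.normSq_coe, Complex.ofReal_one]

lemma cval_reflect (z : Circle) {N : ℕ} {f : ℝ[X]} (hf : f.natDegree ≤ N) :
    cval (reflect N f) z = (z : ℂ) ^ N * (starRingEnd ℂ) (cval f z) := by
  rw [conj_cval]
  exact eval₂_reflect _ (Circle.mul_conj_coe z) hf

lemma integrable_of_continuous_circle (μ : Measure Circle) [IsFiniteMeasure μ] {E : Type*}
    [NormedAddCommGroup E] [SecondCountableTopology E] {f : Circle → E} (hf : Continuous f) :
    Integrable f μ := by
  borelize E
  exact hf.integrable_of_hasCompactSupport (HasCompactSupport.of_compactSpace f)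

/-- The form `∫ Re (f \bar g) dμ` on real polynomials. -/
def circleForm (μ : Measure Circle) [IsFiniteMeasure μ] : LinearMap.BilinForm ℝ ℝ[X] :=
  LinearMap.mk₂ ℝ (fun f g => ∫ z : Circle, (cval f z * (starRingEnd ℂ) (cval g z)).re ∂μ)
    (fun f f' g => by
      rw [← integral_add (integrable_of_continuous_circle μ (by fun_prop))
        (integrable_of_continuous_circle μ (by fun_prop))]
      simp only [cval_add, add_mul, Complex.add_re])
    (fun c f g => by
      rw [smul_eq_mul, ← integral_const_mul]
      simp only [cval_smul, mul_assoc, Complex.re_ofReal_mul])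
    (fun f g g' => by
      rw [← integral_add (integrable_of_continuous_circle μ (by fun_prop))
        (integrable_of_continuous_circle μ (by fun_prop))]
      simp only [cval_add, map_add, mul_add, Complex.add_re])
    (fun c f g => by
      rw [smul_eq_mul, ← integral_const_mul]
      simp only [cval_smul, map_mul, Complex.conj_ofReal, mul_left_comm _ (c : ℂ),
        Complex.re_ofReal_mul])

/-! ### Real orthogonal polynomials on the circle and the Szegő recurrence -/

section Form

variable {μ : Measure Circle} [IsFiniteMeasure μ]

lemma circleForm_apply (f g : ℝ[X]) :
    circleForm μ f g = ∫ z : Circle, (cval f z * (starRingEnd ℂ) (cval g z)).re ∂μ := rfl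

lemma finite_zeros_circle {f : ℂ[X]} (hf : f ≠ 0) : {z : Circle | f.eval (z : ℂ) = 0}.Finite := by
  refine Set.Finite.subset ((f.roots.toFinset.finite_toSet).preimage
    (f := fun z : Circle => (z : ℂ)) (Subtype.coe_injective.injOn)) fun z hz => ?_
  simpa [hf] using hz

lemma posDefForm_circleForm (hμ : NontrivialMeasure μ) : PosDefForm (circleForm μ) where
  symm f g := by
    rw [circleForm_apply, circleForm_apply]
    refine integral_congr_ae (Filter.Eventually.of_forall fun z => ?_)
    simp only [Complex.mul_re, Complex.conj_re, Complex.conj_im]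
    ring
  pos f hf := by
    have e : ∀ z : Circle, (cval f z * (starRingEnd ℂ) (cval f z)).re = Complex.normSq (cval f z) :=
      fun z => by rw [Complex.mul_conj, Complex.ofReal_re]
    simp only [circleForm_apply, e]
    rw [integral_pos_iff_support_of_nonneg (fun z => Complex.normSq_nonneg _)
      (integrable_of_continuous_circle μ (by fun_prop)), pos_iff_ne_zero]
    have hf' : f.map Complex.ofRealHom ≠ 0 :=
      (Polynomial.map_ne_zero_iff Complex.ofRealHom.injective).2 hf
    convert hμ _ (finite_zeros_circle hf') using 2
    ext z
    simp [cval, eval_map]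

lemma circleForm_X_mul (f g : ℝ[X]) : circleForm μ (X * f) (X * g) = circleForm μ f g := by
  rw [circleForm_apply, circleForm_apply]
  refine integral_congr_ae (Filter.Eventually.of_forall fun z => ?_)
  simp only [cval_X_mul, map_mul]
  rw [mul_mul_mul_comm, Circle.mul_conj_coe, one_mul]

/-- On the circle reversal is `f ↦ z^N \bar f`, and conjugation does not change the real part. -/
lemma circleForm_reflect {N : ℕ} {f g : ℝ[X]} (hf : f.natDegree ≤ N) (hg : g.natDegree ≤ N) :
    circleForm μ (reflect N f) (reflect N g) = circleForm μ f g := by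
  rw [circleForm_apply, circleForm_apply]
  refine integral_congr_ae (Filter.Eventually.of_forall fun z => ?_)
  simp only [cval_reflect z hf, cval_reflect z hg, map_mul, map_pow]
  rw [mul_mul_mul_comm, ← mul_pow, Circle.mul_conj_coe, one_pow, one_mul, ← map_mul,
    Complex.conj_re]

/-- Turns orthogonality of `Φ_n` to `1, …, z^{n-1}` into orthogonality of `Φ_n^*` to `z, …, z^n`. -/
lemma circleForm_reflect_X_pow {N k : ℕ} {f : ℝ[X]} (hf : f.natDegree ≤ N) (hk : k ≤ N) :
    circleForm μ (reflect N f) (X ^ k) = circleForm μ f (X ^ (N - k)) := by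
  rw [← circleForm_reflect hf (natDegree_X_pow_le (N - k) |>.trans (Nat.sub_le N k)),
    reflect_monomial, revAt_le (Nat.sub_le N k), Nat.sub_sub_self hk]

/-- The monic orthogonal polynomials as real polynomials. -/
def realOP (μ : Measure Circle) [IsFiniteMeasure μ] (n : ℕ) : ℝ[X] :=
  gramSchmidtPoly (circleForm μ) n

/-- The substitution `z ↦ z⁻¹` preserves `μ` and conjugates `G`, so the integral is real. -/
lemma integral_eq_re (hconj : ConjInvariant μ) {G : Circle → ℂ} (hG : Continuous G)
    (h : ∀ z, G z⁻¹ = (starRingEnd ℂ) (G z)) :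
    ∫ z, G z ∂μ = ((∫ z, (G z).re ∂μ : ℝ) : ℂ) := by
  have h1 : ∫ z, G z ∂μ = (starRingEnd ℂ) (∫ z, G z ∂μ) := by
    rw [← integral_conj]
    simp only [← h]
    conv_lhs => rw [← hconj]
    rw [integral_map (by fun_prop) hG.aestronglyMeasurable]
  have h2 := integral_re (𝕜 := ℂ) (integrable_of_continuous_circle μ hG)
  simp only [RCLike.re_to_complex] at h2
  rw [h2, Complex.conj_eq_iff_re.1 h1.symm]

/-- By invariance the complex Gram-Schmidt coefficients are real, hence equal to those of
`circleForm`. -/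
lemma circleOP_eq (hconj : ConjInvariant μ) (n : ℕ) :
    circleOP μ n = (realOP μ n).map Complex.ofRealHom := by
  induction n using Nat.strong_induction_on with
  | _ n ih =>
    rw [circleOP, realOP, gramSchmidtPoly, Polynomial.map_sub, Polynomial.map_pow, map_X,
      Polynomial.map_sum]
    congr 1
    refine Finset.sum_congr rfl fun k _ => ?_
    have e : ∀ z : ℂ, (circleOP μ k).eval z = cval (realOP μ k) z := fun z => by
      rw [ih k k.2, eval_map, cval]
    rw [Polynomial.map_mul, map_C, ← realOP, ← ih k k.2, Complex.ofRealHom_eq_coe,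
      Complex.ofReal_div]
    congr 3
    · simp only [e]
      rw [integral_eq_re hconj (by fun_prop), circleForm_apply]
      · congr 1
        refine integral_congr_ae (Filter.Eventually.of_forall fun z => ?_)
        simp only [cval_X_pow, Complex.mul_re, Complex.conj_re, Complex.conj_im]
        ring
      · intro z
        simp [conj_cval, Circle.coe_inv_eq_conj, -Circle.coe_inv]
    · rw [circleForm_apply]
      congr 1
      refine integral_congr_ae (Filter.Eventually.of_forall fun z => ?_)
      simp only [e]
      rw [Complex.mul_conj, Complex.ofReal_re, Complex.normSq_eq_norm_sq]

/-- The Verblunsky coefficients with nonnegative index, as real numbers. -/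
def alpha (μ : Measure Circle) [IsFiniteMeasure μ] (n : ℕ) : ℝ := -(realOP μ (n + 1)).coeff 0

lemma verblunsky_eq (hconj : ConjInvariant μ) (n : ℕ) : verblunsky μ (n : ℤ) = alpha μ n := by
  change -(starRingEnd ℂ) ((circleOP μ (n + 1)).eval 0) = _
  rw [circleOP_eq hconj, ← coeff_zero_eq_eval_zero, coeff_map, Complex.ofRealHom_eq_coe,
    Complex.conj_ofReal, alpha, Complex.ofReal_neg]

lemma realOP_monic (n : ℕ) : (realOP μ n).Monic := gramSchmidtPoly_monic _ n

@[simp] lemma realOP_natDegree (n : ℕ) : (realOP μ n).natDegree = n := gramSchmidtPoly_natDegree _ n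

/-- Testing on the monomials that occur in `D` suffices, since `D` is their combination. Vanishing
end coefficients thus remove the powers for which orthogonality fails. -/
lemma eq_zero_of_support (hμ : NontrivialMeasure μ) {D : ℝ[X]}
    (h : ∀ k ∈ D.support, circleForm μ D (X ^ k) = 0) : D = 0 := by
  by_contra hne
  refine ((posDefForm_circleForm hμ).pos D hne).ne' ?_
  calc circleForm μ D D = circleForm μ D (∑ k ∈ D.support, C (D.coeff k) * X ^ k) :=
        congrArg _ D.as_sum_support_C_mul_X_pow
    _ = 0 := by
        simp only [map_sum, ← smul_eq_C_mul, map_smul]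
        exact Finset.sum_eq_zero fun k hk => by rw [h k hk, smul_zero]

lemma circleForm_realOP_X_pow (hμ : NontrivialMeasure μ) {n k : ℕ} (hk : k < n) :
    circleForm μ (realOP μ n) (X ^ k) = 0 :=
  gramSchmidtPoly_orthogonal (posDefForm_circleForm hμ) (by
    rw [degree_X_pow]; exact_mod_cast hk)

lemma coeff_zero_reflect_realOP (n : ℕ) : (reflect n (realOP μ n)).coeff 0 = 1 := by
  rw [coeff_reflect, revAt_le n.zero_le, Nat.sub_zero]
  simpa using (realOP_monic (μ := μ) n).coeff_natDegree

lemma natDegree_reflect_realOP_le (n : ℕ) : (reflect n (realOP μ n)).natDegree ≤ n :=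
  natDegree_reflect_le.trans (by simp)

/-- The Szegő recurrence. -/
lemma X_mul_realOP (hμ : NontrivialMeasure μ) (n : ℕ) :
    X * realOP μ n = realOP μ (n + 1) + C (alpha μ n) * reflect n (realOP μ n) := by
  rw [← sub_eq_zero, ← sub_sub]
  refine eq_zero_of_support hμ fun k hk => ?_
  -- All three terms are orthogonal to `z, …, z^n`; the choice of `alpha` removes the constant
  -- coefficient.
  set D := X * realOP μ n - realOP μ (n + 1) - C (alpha μ n) * reflect n (realOP μ n) with hD
  have h0 : D.coeff 0 = 0 := by
    rw [hD, coeff_sub, coeff_sub, coeff_C_mul, coeff_zero_reflect_realOP, coeff_X_mul_zero, alpha]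
    ring
  have hd : D.degree < ((n + 1 : ℕ) : WithBot ℕ) := by
    refine (degree_sub_le _ _).trans_lt (max_lt (degree_lt_of_monic_sub
      (monic_X.mul (realOP_monic n)) (realOP_monic _) ?_ (realOP_natDegree _)) ?_)
    · rw [monic_X.natDegree_mul (realOP_monic n)]
      simp [add_comm]
    · refine (degree_C_mul_le_degree _ _).trans_lt ((degree_le_of_natDegree_le
        (natDegree_reflect_realOP_le n)).trans_lt ?_)
      exact_mod_cast n.lt_succ_self
  have hk0 : k ≠ 0 := by rintro rfl; exact (mem_support_iff.1 hk) h0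
  obtain ⟨j, rfl⟩ := Nat.exists_eq_succ_of_ne_zero hk0
  have hkn : ((j + 1 : ℕ) : WithBot ℕ) < ((n + 1 : ℕ) : WithBot ℕ) :=
    (le_degree_of_mem_supp _ hk).trans_lt hd
  have hjn : j < n := by
    have : j + 1 < n + 1 := by exact_mod_cast hkn
    omega
  have e1 : circleForm μ (X * realOP μ n) (X ^ (j + 1)) = 0 := by
    rw [pow_succ', circleForm_X_mul, circleForm_realOP_X_pow hμ hjn]
  have e2 : circleForm μ (realOP μ (n + 1)) (X ^ (j + 1)) = 0 :=
    circleForm_realOP_X_pow hμ (by omega)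
  have e3 : circleForm μ (reflect n (realOP μ n)) (X ^ (j + 1)) = 0 := by
    rw [circleForm_reflect_X_pow (by simp) (by omega), circleForm_realOP_X_pow hμ (by omega)]
  rw [Nat.succ_eq_add_one, hD, ← smul_eq_C_mul, map_sub, map_sub, map_smul]
  simp [e1, e2, e3]

/-- Multiplication by `z` and reversal are isometric and `Φ_{n+1} ⊥ Φ_n^*`, so the recurrence gives
`‖Φ_{n+1}‖² = (1 - α_n²) ‖Φ_n‖²`. -/
lemma alpha_sq_lt_one (hμ : NontrivialMeasure μ) (n : ℕ) : alpha μ n ^ 2 < 1 := by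
  have hB := posDefForm_circleForm hμ
  set R := reflect n (realOP μ n) with hR
  have h1 : circleForm μ (realOP μ (n + 1)) R = 0 := by
    refine gramSchmidtPoly_orthogonal hB ((degree_le_of_natDegree_le
        (natDegree_reflect_realOP_le n)).trans_lt ?_)
    exact_mod_cast n.lt_succ_self
  have h2 : circleForm μ R R = circleForm μ (realOP μ n) (realOP μ n) :=
    circleForm_reflect (by simp) (by simp)
  have h3 := circleForm_X_mul (μ := μ) (realOP μ n) (realOP μ n)
  rw [X_mul_realOP hμ, ← hR, ← smul_eq_C_mul] at h3
  simp only [map_add, LinearMap.add_apply, map_smul, LinearMap.smul_apply, smul_eq_mul, h1,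
    hB.symm R, h2] at h3
  have h4 := hB.pos _ (realOP_monic (μ := μ) n).ne_zero
  have h5 := hB.pos _ (realOP_monic (μ := μ) (n + 1)).ne_zero
  by_contra hge
  nlinarith

/-- At `±1` reversal only multiplies the value by `(±1)^n`, which closes the Szegő recurrence; see
also `realOP_eval_neg_one`. -/
lemma realOP_eval_one (hμ : NontrivialMeasure μ) (n : ℕ) :
    (realOP μ (n + 1)).eval 1 = (1 - alpha μ n) * (realOP μ n).eval 1 := by
  have h := congrArg (eval 1) (X_mul_realOP hμ n)
  have hr : (reflect n (realOP μ n)).eval 1 = (realOP μ n).eval 1 := by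
    have := eval₂_reflect (RingHom.id ℝ) (mul_one (1 : ℝ)) (f := realOP μ n) (N := n) (by simp)
    simpa using this
  simp only [eval_mul, eval_add, eval_X, eval_C, hr] at h
  linarith

lemma reflect_eval_neg_one {f : ℝ[X]} {n : ℕ} (hf : f.natDegree ≤ n) :
    (reflect n f).eval (-1) = (-1) ^ n * f.eval (-1) := by
  have := eval₂_reflect (RingHom.id ℝ) (by norm_num : (-1 : ℝ) * (-1) = 1) hf
  simpa using this

lemma realOP_eval_neg_one (hμ : NontrivialMeasure μ) (n : ℕ) :
    (realOP μ (n + 1)).eval (-1) = -(1 + (-1) ^ n * alpha μ n) * (realOP μ n).eval (-1) := by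
  have h := congrArg (eval (-1)) (X_mul_realOP hμ n)
  simp only [eval_mul, eval_add, eval_X, eval_C,
    reflect_eval_neg_one (realOP_natDegree (μ := μ) n).le] at h
  linarith

end Form

/-! ### The Szegő mapping -/

/-- From `z^{m+2} = (z + \bar z) z^{m+1} - z^m`; it expresses `2 cos mθ` through `2 cos θ`. -/
lemma exists_vieta_lucas (m : ℕ) : ∃ T : ℝ[X], T.natDegree ≤ m ∧
    ∀ z : Circle, T.eval (2 * (z : ℂ).re) = 2 * ((z : ℂ) ^ m).re := by
  induction m using Nat.strong_induction_on with
  | _ m ih =>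
    match m with
    | 0 => exact ⟨C 2, by simp, fun z => by simp⟩
    | 1 => exact ⟨X, by simp, fun z => by simp⟩
    | m + 2 =>
      obtain ⟨T, hT, hTz⟩ := ih m (by omega)
      obtain ⟨U, hU, hUz⟩ := ih (m + 1) (by omega)
      refine ⟨X * U - T, ?_, fun z => ?_⟩
      · refine (natDegree_sub_le _ _).trans (max_le (natDegree_mul_le.trans ?_) (by omega))
        have := natDegree_X_le (R := ℝ)
        omega
      · have h : (z : ℂ) ^ (m + 2) = ((2 * (z : ℂ).re : ℝ) : ℂ) * (z : ℂ) ^ (m + 1) - z ^ m := by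
          have h1 := Circle.mul_conj_coe z
          have h2 := Complex.add_conj (z : ℂ)
          rw [← h2]
          linear_combination (-(z : ℂ) ^ m) * h1
        rw [h, Complex.sub_re, Complex.re_ofReal_mul, eval_sub, eval_mul, eval_X, hUz, hTz]
        ring

/-- `z ^ n p (z + 1 / z)` as a polynomial in `z`. -/
def szegoPoly (n : ℕ) (p : ℝ[X]) : ℝ[X] :=
  ∑ k ∈ Finset.range (n + 1), C (p.coeff k) * (X ^ (n - k) * (X ^ 2 + 1) ^ k)

lemma eval₂_szegoPoly {K : Type*} [Field K] (i : ℝ →+* K) {x y : K} (hxy : x * y = 1) {n : ℕ}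
    {p : ℝ[X]} (hp : p.natDegree ≤ n) :
    eval₂ i x (szegoPoly n p) = x ^ n * eval₂ i (x + y) p := by
  rw [szegoPoly, eval₂_finsetSum, eval₂_eq_sum_range' i (Nat.lt_succ_of_le hp), Finset.mul_sum]
  refine Finset.sum_congr rfl fun k hk => ?_
  have hk' : k ≤ n := Nat.lt_succ_iff.1 (Finset.mem_range.1 hk)
  have h1 : x ^ 2 + 1 = x * (x + y) := by rw [mul_add, hxy, sq]
  simp only [eval₂_mul, eval₂_C, eval₂_pow, eval₂_add, eval₂_X, eval₂_one]
  rw [h1, mul_pow, ← mul_assoc (x ^ (n - k)), ← pow_add, Nat.sub_add_cancel hk']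
  ring

lemma monic_X_sq_add_one_pow (k : ℕ) :
    ((X ^ 2 + 1 : ℝ[X]) ^ k).Monic ∧ ((X ^ 2 + 1 : ℝ[X]) ^ k).natDegree = 2 * k := by
  have h : (X ^ 2 + 1 : ℝ[X]).Monic := monic_X_pow_add_C (1 : ℝ) two_ne_zero
  refine ⟨h.pow k, ?_⟩
  rw [h.natDegree_pow, show (X ^ 2 + 1 : ℝ[X]) = X ^ 2 + C 1 by simp, natDegree_X_pow_add_C,
    mul_comm]

/-- The `k`-th summand has degree at most `n + k`, so only `k = n` reaches the top. -/
lemma szegoPoly_monic {n : ℕ} {p : ℝ[X]} (hp : p.Monic) (hn : p.natDegree = n) :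
    (szegoPoly n p).Monic ∧ (szegoPoly n p).natDegree = 2 * n := by
  obtain ⟨hm, hd⟩ := monic_X_sq_add_one_pow n
  have hc : p.coeff n = 1 := by rw [← hn]; exact hp.coeff_natDegree
  rw [szegoPoly, Finset.sum_range_succ, hc, Nat.sub_self, pow_zero, one_mul, C_1, one_mul]
  set S := ∑ k ∈ Finset.range n, C (p.coeff k) * (X ^ (n - k) * (X ^ 2 + 1 : ℝ[X]) ^ k)
  have hlt : S.degree < ((X ^ 2 + 1 : ℝ[X]) ^ n).degree := by
    rw [degree_eq_natDegree hm.ne_zero, hd]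
    rw [← Polynomial.mem_degreeLT]
    refine Submodule.sum_mem _ fun k hk => ?_
    rw [Polynomial.mem_degreeLT]
    refine (degree_C_mul_le_degree _ _).trans_lt ?_
    have hk' := Finset.mem_range.1 hk
    obtain ⟨hm', hd'⟩ := monic_X_sq_add_one_pow k
    rw [degree_eq_natDegree ((monic_X_pow _).mul hm').ne_zero, (monic_X_pow _).natDegree_mul hm',
      natDegree_X_pow, hd']
    exact_mod_cast (by omega : n - k + 2 * k < 2 * n)
  refine ⟨hm.add_of_right hlt, ?_⟩
  rw [natDegree_add_eq_right_of_degree_lt hlt, hd]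

lemma coeff_zero_szegoPoly {n : ℕ} {p : ℝ[X]} (hp : p.Monic) (hn : p.natDegree = n) :
    (szegoPoly n p).coeff 0 = 1 := by
  have hc : p.coeff n = 1 := by rw [← hn]; exact hp.coeff_natDegree
  rw [coeff_zero_eq_eval_zero, szegoPoly, eval_finsetSum, Finset.sum_range_succ,
    Finset.sum_eq_zero fun k hk => ?_]
  · simp [hc]
  · have hk' := Finset.mem_range.1 hk
    have : (0 : ℝ) ^ (n - k) = 0 := zero_pow (by omega)
    simp [this]

lemma measurable_two_re : Measurable fun z : Circle => 2 * (z : ℂ).re :=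
  (by fun_prop : Continuous fun z : Circle => 2 * (z : ℂ).re).measurable

lemma szegoE_singleton {μ : Measure Circle} {x : ℝ} {w : Circle} (h : ∀ z : Circle, 2 * (z : ℂ).re = x → z = w)
    (hw : μ {w} = 0) : szegoE μ {x} = 0 := by
  rw [szegoE, Measure.map_apply measurable_two_re (measurableSet_singleton x)]
  exact measure_mono_null (fun z hz => h z hz) hw

section Szego

variable {μ : Measure Circle} [IsProbabilityMeasure μ]

lemma szegoE_admissible (hμ : NontrivialMeasure μ) : Admissible (szegoE μ) where
  prob := Measure.isProbabilityMeasure_map measurable_two_re.aemeasurable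
  supp := by
    rw [szegoE, Measure.map_apply measurable_two_re measurableSet_Icc.compl]
    convert measure_empty (μ := μ)
    refine Set.eq_empty_of_forall_notMem fun z hz => hz ?_
    have h1 := Complex.abs_re_le_norm (z : ℂ)
    rw [Circle.norm_coe, abs_le] at h1
    constructor <;> linarith
  nontrivial s hs := by
    rw [szegoE, Measure.map_apply measurable_two_re hs.measurableSet.compl, Set.preimage_compl]
    refine hμ _ (hs.preimage' fun a _ => ?_)
    -- Points of the circle over `a` are roots of this quadratic, so fibres are finite.
    have hne : (X ^ 2 - C (a : ℂ) * X + 1 : ℂ[X]) ≠ 0 := fun h0 => by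
      have := congrArg (eval 0) h0
      simp at this
    refine (finite_zeros_circle hne).subset fun z hz => ?_
    have h1 := Circle.mul_conj_coe z
    have h2 := Complex.add_conj (z : ℂ)
    have h3 : 2 * (z : ℂ).re = a := hz
    rw [h3] at h2
    simp only [Set.mem_ofPred_eq, eval_add, eval_sub, eval_mul, eval_pow, eval_X, eval_C, eval_one]
    linear_combination (z : ℂ) * h2 - h1

/-- The pairing is `∫ p(2 cos θ) cos((n - j)θ) dμ`, and the cosine is a polynomial in `2 cos θ` of
degree at most `|n - j| < n`. -/
lemma circleForm_szegoPoly (hμ : NontrivialMeasure μ) {n j : ℕ} (hj0 : j ≠ 0) (hj : j < 2 * n) :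
    circleForm μ (szegoPoly n (functionalOP (lineFunctional (szegoE μ)) n)) (X ^ j) = 0 := by
  have h := szegoE_admissible hμ
  set p := functionalOP (lineFunctional (szegoE μ)) n with hp
  -- With truncated subtraction, `(n - j) + (j - n)` is `|n - j|`.
  obtain ⟨T, hT, hTz⟩ := exists_vieta_lucas ((n - j) + (j - n))
  have hpT : lineFunctional (szegoE μ) (p * T) = 0 := by
    refine functionalOP_orthogonal h.lineFunctional_pos ((degree_le_of_natDegree_le hT).trans_lt ?_)
    exact_mod_cast (by omega : (n - j) + (j - n) < n)
  rw [h.lineFunctional_apply, szegoE,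
    integral_map measurable_two_re.aemeasurable
      (Polynomial.continuous _).aestronglyMeasurable] at hpT
  rw [circleForm_apply, ← mul_zero (1 / 2 : ℝ), ← hpT, ← integral_const_mul]
  refine integral_congr_ae (Filter.Eventually.of_forall fun z => ?_)
  have h1 := Circle.mul_conj_coe z
  have h2 : cval (szegoPoly n p) z = (z : ℂ) ^ n * ((p.eval (2 * (z : ℂ).re) : ℝ) : ℂ) := by
    rw [cval, eval₂_szegoPoly _ h1 (by simp [hp]), Complex.add_conj]
    congr 1
    exact (Polynomial.hom_eval₂ p (RingHom.id ℝ) Complex.ofRealHom _).symm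
  have h3 : ((z : ℂ) ^ n * (starRingEnd ℂ) ((z : ℂ) ^ j)).re =
      ((z : ℂ) ^ ((n - j) + (j - n))).re := by
    rcases le_total j n with hjn | hjn
    · obtain ⟨d, rfl⟩ := Nat.exists_eq_add_of_le hjn
      rw [map_pow, pow_add, mul_right_comm, ← mul_pow, h1]
      simp
    · obtain ⟨d, rfl⟩ := Nat.exists_eq_add_of_le hjn
      rw [map_pow, pow_add, ← mul_assoc, ← mul_pow, h1, ← map_pow, one_pow, one_mul,
        Complex.conj_re]
      simp
  simp only [h2, cval_X_pow, eval_mul, hTz, ← h3]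
  rw [mul_right_comm, mul_comm, Complex.re_ofReal_mul]
  ring

/-- `(1 - α_{2n+1}) z^{n+1} P_{n+1}(z + 1/z) = Φ_{2n+2}(z) + Φ_{2n+2}^*(z)`. -/
lemma szegoPoly_eq (hμ : NontrivialMeasure μ) (n : ℕ) :
    C (1 - alpha μ (2 * n + 1)) *
        szegoPoly (n + 1) (functionalOP (lineFunctional (szegoE μ)) (n + 1)) =
      realOP μ (2 * n + 2) + reflect (2 * n + 2) (realOP μ (2 * n + 2)) := by
  set p := functionalOP (lineFunctional (szegoE μ)) (n + 1) with hp
  have hpd : p.natDegree = n + 1 := functionalOP_natDegree _ _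
  have hpm : p.Monic := functionalOP_monic _ _
  obtain ⟨hm, hd⟩ := szegoPoly_monic hpm hpd
  rw [← sub_eq_zero, ← sub_sub]
  refine eq_zero_of_support hμ fun j hj => ?_
  set H := szegoPoly (n + 1) p with hH
  set Q := realOP μ (2 * n + 2) with hQ
  have hQd : Q.natDegree = 2 * n + 2 := realOP_natDegree _
  have hQm : Q.Monic := realOP_monic _
  -- Every term is orthogonal to `z, …, z^{2n+1}`. The coefficients of `1` and `z^{2n+2}` equal `1 -
  -- α_{2n+1}` on both sides, so they cancel in `D`.
  set D := C (1 - alpha μ (2 * n + 1)) * H - Q - reflect (2 * n + 2) Q with hD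
  have hQ0 : Q.coeff 0 = -alpha μ (2 * n + 1) := by rw [alpha, neg_neg]
  have hQt : Q.coeff (2 * n + 2) = 1 := by rw [← hQd]; exact hQm.coeff_natDegree
  have hHt : H.coeff (2 * n + 2) = 1 := by
    rw [show 2 * n + 2 = H.natDegree by rw [hd]; ring]; exact hm.coeff_natDegree
  have h0 : D.coeff 0 = 0 := by
    rw [hD, coeff_sub, coeff_sub, coeff_C_mul, coeff_zero_reflect_realOP, hQ0,
      coeff_zero_szegoPoly hpm hpd]
    ring
  have ht : D.coeff (2 * n + 2) = 0 := by
    rw [hD, coeff_sub, coeff_sub, coeff_C_mul, coeff_reflect, revAt_le le_rfl, Nat.sub_self,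
      hQ0, hQt, hHt]
    ring
  have hDd : D.natDegree ≤ 2 * n + 2 := by
    refine (natDegree_sub_le _ _).trans (max_le ((natDegree_sub_le _ _).trans (max_le ?_ hQd.le))
      (natDegree_reflect_realOP_le _))
    exact (natDegree_C_mul_le _ _).trans (by omega)
  have hj' := mem_support_iff.1 hj
  have hj0 : j ≠ 0 := by rintro rfl; exact hj' h0
  have hj1 : j ≠ 2 * n + 2 := by rintro rfl; exact hj' ht
  have hj2 : j ≤ 2 * n + 2 := (le_natDegree_of_ne_zero hj').trans hDd
  have e1 : circleForm μ H (X ^ j) = 0 := circleForm_szegoPoly hμ hj0 (by omega)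
  have e2 : circleForm μ Q (X ^ j) = 0 := circleForm_realOP_X_pow hμ (by omega)
  have e3 : circleForm μ (reflect (2 * n + 2) Q) (X ^ j) = 0 := by
    rw [circleForm_reflect_X_pow hQd.le hj2, circleForm_realOP_X_pow hμ (by omega)]
  rw [hD, ← smul_eq_C_mul, map_sub, map_sub, map_smul]
  simp [e1, e2, e3]

/-- The Verblunsky coefficients `α_{2n-1}`, with `α_{-1} = -1`. -/
def oddAlpha (μ : Measure Circle) [IsFiniteMeasure μ] : ℕ → ℝ
  | 0 => -1
  | n + 1 => alpha μ (2 * n + 1)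

lemma P_szegoE (hμ : NontrivialMeasure μ) (n : ℕ) :
    (1 - oddAlpha μ n) * P (szegoE μ) n 2 = 2 * (realOP μ (2 * n)).eval 1 ∧
    (1 - oddAlpha μ n) * ((-1) ^ n * P (szegoE μ) n (-2)) = 2 * (realOP μ (2 * n)).eval (-1) := by
  have h := szegoE_admissible hμ
  rw [h.P_eq, h.P_eq]
  cases n with
  -- Here `α_{-1} = -1` supplies the factor `2`.
  | zero => simp [oddAlpha, realOP, gramSchmidtPoly_zero]; norm_num
  | succ n =>
    have key := szegoPoly_eq hμ n
    have hr : ∀ x : ℝ, x * x = 1 → (szegoPoly (n + 1) (functionalOP (lineFunctional (szegoE μ))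
        (n + 1))).eval x = x ^ (n + 1) *
        (functionalOP (lineFunctional (szegoE μ)) (n + 1)).eval (x + x) := fun x hx =>
      eval₂_szegoPoly (RingHom.id ℝ) hx (by simp)
    have hs : ∀ x : ℝ, x * x = 1 → (reflect (2 * n + 2) (realOP μ (2 * n + 2))).eval x =
        x ^ (2 * n + 2) * (realOP μ (2 * n + 2)).eval x := fun x hx =>
      eval₂_reflect (RingHom.id ℝ) hx (by simp)
    have k1 := congrArg (eval 1) key
    have k2 := congrArg (eval (-1)) key
    rw [eval_mul, eval_C, eval_add, hr _ (by norm_num), hs _ (by norm_num)] at k1 k2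
    have hpow : (-1 : ℝ) ^ (2 * n + 2) = 1 := by rw [← mul_add_one, pow_mul]; simp
    rw [hpow] at k2
    norm_num at k1 k2
    rw [oddAlpha, mul_add_one]
    exact ⟨by linarith, by linarith⟩

lemma oddAlpha_lt_one (hμ : NontrivialMeasure μ) (n : ℕ) : oddAlpha μ n < 1 := by
  cases n with
  | zero => norm_num [oddAlpha]
  | succ n => exact (abs_lt.1 ((sq_lt_one_iff_abs_lt_one _).1 (alpha_sq_lt_one hμ (2 * n + 1)))).2

/-- Two Szegő steps contribute `(1 - α_{2n})(1 - α_{2n+1})`; the second factor cancels against the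
normalization in `P_szegoE`. -/
lemma evalRatio_szegoE_two (hμ : NontrivialMeasure μ) (n : ℕ) :
    evalRatio (szegoE μ) 2 n = (1 - alpha μ (2 * n)) * (1 - oddAlpha μ n) := by
  have h := szegoE_admissible hμ
  have h0 := (P_szegoE hμ n).1
  have h1 := (P_szegoE hμ (n + 1)).1
  rw [mul_add_one, realOP_eval_one hμ, realOP_eval_one hμ, oddAlpha] at h1
  have hlt : 1 - alpha μ (2 * n + 1) ≠ 0 := (sub_pos.2 (oddAlpha_lt_one hμ (n + 1))).ne'
  rw [evalRatio, div_eq_iff (h.P_ne_zero (isEdge_two neg_one_lt_zero) n)]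
  apply mul_left_cancel₀ hlt
  linear_combination h1 - (1 - alpha μ (2 * n + 1)) * (1 - alpha μ (2 * n)) * h0

lemma evalRatio_szegoE_neg_two (hμ : NontrivialMeasure μ) (n : ℕ) :
    evalRatio (szegoE μ) (-2) n = -((1 + alpha μ (2 * n)) * (1 - oddAlpha μ n)) := by
  have h := szegoE_admissible hμ
  have h0 := (P_szegoE hμ n).2
  have h1 := (P_szegoE hμ (n + 1)).2
  rw [mul_add_one, realOP_eval_neg_one hμ, realOP_eval_neg_one hμ, oddAlpha, pow_succ, pow_succ,
    pow_mul, neg_one_sq, one_pow] at h1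
  have hlt : 1 - alpha μ (2 * n + 1) ≠ 0 := (sub_pos.2 (oddAlpha_lt_one hμ (n + 1))).ne'
  have hs : (-1 : ℝ) ^ n ≠ 0 := pow_ne_zero _ (by norm_num)
  rw [evalRatio, div_eq_iff (h.P_ne_zero (isEdge_neg_two one_pos) n)]
  apply mul_left_cancel₀ (mul_ne_zero hlt hs)
  linear_combination -h1 + (1 - alpha μ (2 * n + 1)) * (1 + alpha μ (2 * n)) * h0

/-- Subtracting the recurrences for the ratios at `2` and `-2` eliminates `b_{n+2}` and leaves a
linear equation for `a_{n+1}²`. -/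
lemma normRatio_szegoE (hμ : NontrivialMeasure μ) (n : ℕ) :
    normRatio (szegoE μ) n = (1 + alpha μ (2 * n + 1)) * (1 - oddAlpha μ n) *
      (1 - alpha μ (2 * n) ^ 2) := by
  have h := szegoE_admissible hμ
  have h1 := h.evalRatio_succ (isEdge_two neg_one_lt_zero) n
  have h2 := h.evalRatio_succ (isEdge_neg_two one_pos) n
  have n1 := h.evalRatio_ne_zero (isEdge_two neg_one_lt_zero) n
  have n2 := h.evalRatio_ne_zero (isEdge_neg_two one_pos) n
  rw [evalRatio_szegoE_two hμ] at h1 n1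
  rw [evalRatio_szegoE_neg_two hμ] at h2 n2
  rw [evalRatio_szegoE_two hμ, oddAlpha] at h1
  rw [evalRatio_szegoE_neg_two hμ, oddAlpha] at h2
  have m1 := left_ne_zero_of_mul n1
  have m2 := right_ne_zero_of_mul n1
  have m3 := left_ne_zero_of_mul (neg_ne_zero.1 n2)
  have h3 : normRatio (szegoE μ) n / ((1 - alpha μ (2 * n)) * (1 - oddAlpha μ n)) +
      normRatio (szegoE μ) n / ((1 + alpha μ (2 * n)) * (1 - oddAlpha μ n)) =
      2 * (1 + alpha μ (2 * n + 1)) := by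
    rw [div_neg] at h2
    linarith
  field_simp at h3
  linarith

end Szego

lemma szegoE_two {μ : Measure Circle} (h : μ {1} = 0) : szegoE μ {2} = 0 := by
  refine szegoE_singleton (w := 1) (fun z hz => ?_) h
  have h1 := Circle.normSq_coe z
  rw [Complex.normSq_apply] at h1
  have hre : (z : ℂ).re = 1 := by linarith
  rw [hre] at h1
  exact Circle.ext (Complex.ext (by simpa using hre) (by simpa using h1))

lemma szegoE_neg_two {μ : Measure Circle} (h : μ {-1} = 0) : szegoE μ {-2} = 0 := by
  refine szegoE_singleton (w := -1) (fun z hz => ?_) h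
  have h1 := Circle.normSq_coe z
  rw [Complex.normSq_apply] at h1
  have hre : (z : ℂ).re = -1 := by linarith
  rw [hre] at h1
  exact Circle.ext (Complex.ext (by simpa using hre) (by simpa using h1))

/-! ### The measures (+), (-) and (o) as linear weights -/

section Mappings

variable {μ : Measure Circle} [IsProbabilityMeasure μ]

lemma abs_alpha_lt_one (hμ : NontrivialMeasure μ) (n : ℕ) : |alpha μ n| < 1 :=
  (sq_lt_one_iff_abs_lt_one _).1 (alpha_sq_lt_one hμ n)

lemma one_sub_alpha_pos (hμ : NontrivialMeasure μ) (n : ℕ) : 0 < 1 - alpha μ n :=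
  sub_pos.2 (abs_lt.1 (abs_alpha_lt_one hμ n)).2

lemma one_add_alpha_pos (hμ : NontrivialMeasure μ) (n : ℕ) : 0 < 1 + alpha μ n := by
  linarith [(abs_lt.1 (abs_alpha_lt_one hμ n)).1]

lemma cPlus_sq (hμ : NontrivialMeasure μ) (hconj : ConjInvariant μ) :
    cPlus μ ^ 2 = 1 / (2 * (1 - alpha μ 0)) := by
  have h := one_sub_alpha_pos hμ 0
  have hv := verblunsky_eq hconj 0
  rw [Nat.cast_zero] at hv
  rw [cPlus, hv, Complex.ofReal_re, div_pow, one_pow, Real.sq_sqrt (by positivity)]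

lemma cMinus_sq (hμ : NontrivialMeasure μ) (hconj : ConjInvariant μ) :
    cMinus μ ^ 2 = 1 / (2 * (1 + alpha μ 0)) := by
  have h := one_add_alpha_pos hμ 0
  have hv := verblunsky_eq hconj 0
  rw [Nat.cast_zero] at hv
  rw [cMinus, hv, Complex.ofReal_re, div_pow, one_pow, Real.sq_sqrt (by positivity)]

lemma cO_sq (hμ : NontrivialMeasure μ) (hconj : ConjInvariant μ) :
    cO μ ^ 2 = 1 / (2 * (1 - alpha μ 0 ^ 2) * (1 - alpha μ 1)) := by
  have h := one_sub_alpha_pos hμ 1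
  have h0 : 0 < 1 - alpha μ 0 ^ 2 := sub_pos.2 (alpha_sq_lt_one hμ 0)
  have hv := verblunsky_eq hconj 0
  have hv1 := verblunsky_eq hconj 1
  rw [Nat.cast_zero] at hv
  rw [Nat.cast_one] at hv1
  rw [cO, hv, hv1, Complex.ofReal_re, Complex.norm_real, Real.norm_eq_abs, sq_abs, div_pow,
    one_pow, Real.sq_sqrt (by positivity)]

lemma szego_plus_eq (μ : Measure Circle) :
    szego μ .plus = edgeMeasure (szegoE μ) (-cPlus μ ^ 2) 2 := by
  rw [szego, edgeMeasure]
  congr 1; funext x; congr 1; ring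

lemma szego_minus_eq (μ : Measure Circle) :
    szego μ .minus = edgeMeasure (szegoE μ) (cMinus μ ^ 2) (-2) := by
  rw [szego, edgeMeasure]
  congr 1; funext x; congr 1; ring

lemma isEdge_cPlus (hμ : NontrivialMeasure μ) (hconj : ConjInvariant μ) :
    IsEdge (-cPlus μ ^ 2) 2 := by
  have h := one_sub_alpha_pos hμ 0
  refine isEdge_two (neg_lt_zero.2 ?_)
  rw [cPlus_sq hμ hconj]
  positivity

lemma isEdge_cMinus (hμ : NontrivialMeasure μ) (hconj : ConjInvariant μ) :
    IsEdge (cMinus μ ^ 2) (-2) := by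
  have h := one_add_alpha_pos hμ 0
  refine isEdge_neg_two ?_
  rw [cMinus_sq hμ hconj]
  positivity

/-- The mass is `c₊² (1 - α_0)(1 - α_{-1}) = 2 c₊² (1 - α_0)`, which explains the value of `c₊`. -/
lemma szego_plus_admissible (hμ : NontrivialMeasure μ) (hconj : ConjInvariant μ) :
    Admissible (edgeMeasure (szegoE μ) (-cPlus μ ^ 2) 2) := by
  have h := szegoE_admissible hμ
  refine h.edgeMeasure_admissible (isEdge_cPlus hμ hconj) ?_
  have h0 := (one_sub_alpha_pos hμ 0).ne'
  rw [h.integral_edge, evalRatio_szegoE_two hμ, cPlus_sq hμ hconj, oddAlpha]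
  field_simp
  norm_num

lemma szego_minus_admissible (hμ : NontrivialMeasure μ) (hconj : ConjInvariant μ) :
    Admissible (edgeMeasure (szegoE μ) (cMinus μ ^ 2) (-2)) := by
  have h := szegoE_admissible hμ
  refine h.edgeMeasure_admissible (isEdge_cMinus hμ hconj) ?_
  have h0 := (one_add_alpha_pos hμ 0).ne'
  rw [h.integral_edge, evalRatio_szegoE_neg_two hμ, cMinus_sq hμ hconj, oddAlpha]
  field_simp
  norm_num

/-- In the difference of the two edge ratios of (e) the coefficient `α_{2n}` drops out, leaving `-2
(1 - α_{2n-1})`. -/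
lemma evalRatio_szego_plus (hμ : NontrivialMeasure μ) (hconj : ConjInvariant μ) (n : ℕ) :
    evalRatio (szego μ .plus) (-2) n =
      -((1 - alpha μ (2 * n + 1)) * (1 + alpha μ (2 * n))) := by
  have h := szegoE_admissible hμ
  rw [szego_plus_eq, h.evalRatio_edgeMeasure (isEdge_cPlus hμ hconj) (szego_plus_admissible hμ hconj)
    (isEdge_neg_two one_pos) (by norm_num)]
  simp only [evalRatio_szegoE_two hμ, evalRatio_szegoE_neg_two hμ]
  have h1 := (sub_pos.2 (oddAlpha_lt_one hμ n)).ne'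
  have e : -((1 + alpha μ (2 * n)) * (1 - oddAlpha μ n)) -
    (1 - alpha μ (2 * n)) * (1 - oddAlpha μ n) = -2 * (1 - oddAlpha μ n) := by ring
  rw [e, div_eq_iff (by simpa using h1), oddAlpha]
  ring

lemma evalRatio_szego_minus (hμ : NontrivialMeasure μ) (hconj : ConjInvariant μ) (n : ℕ) :
    evalRatio (szego μ .minus) 2 n = (1 - alpha μ (2 * n + 1)) * (1 - alpha μ (2 * n)) := by
  have h := szegoE_admissible hμ
  rw [szego_minus_eq, h.evalRatio_edgeMeasure (isEdge_cMinus hμ hconj)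
    (szego_minus_admissible hμ hconj) (isEdge_two neg_one_lt_zero) (by norm_num)]
  simp only [evalRatio_szegoE_two hμ, evalRatio_szegoE_neg_two hμ]
  have h1 := (sub_pos.2 (oddAlpha_lt_one hμ n)).ne'
  have e : (1 - alpha μ (2 * n)) * (1 - oddAlpha μ n) -
    -((1 + alpha μ (2 * n)) * (1 - oddAlpha μ n)) = 2 * (1 - oddAlpha μ n) := by ring
  rw [e, div_eq_iff (by simpa using h1), oddAlpha]
  ring

lemma normRatio_szego_plus (hμ : NontrivialMeasure μ) (hconj : ConjInvariant μ) (n : ℕ) :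
    normRatio (szego μ .plus) n =
      (1 - alpha μ (2 * n + 2)) * (1 - alpha μ (2 * n + 1) ^ 2) * (1 + alpha μ (2 * n)) := by
  have h := szegoE_admissible hμ
  have h1 := (sub_pos.2 (oddAlpha_lt_one hμ n)).ne'
  have h2 := (one_sub_alpha_pos hμ (2 * n)).ne'
  rw [szego_plus_eq, h.normRatio_edgeMeasure (isEdge_cPlus hμ hconj)
    (szego_plus_admissible hμ hconj), evalRatio_szegoE_two hμ, evalRatio_szegoE_two hμ,
    normRatio_szegoE hμ, oddAlpha, mul_add_one]
  field_simp
  ring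

lemma normRatio_szego_minus (hμ : NontrivialMeasure μ) (hconj : ConjInvariant μ) (n : ℕ) :
    normRatio (szego μ .minus) n =
      (1 + alpha μ (2 * n + 2)) * (1 - alpha μ (2 * n + 1) ^ 2) * (1 - alpha μ (2 * n)) := by
  have h := szegoE_admissible hμ
  have h1 := (sub_pos.2 (oddAlpha_lt_one hμ n)).ne'
  have h2 := (one_add_alpha_pos hμ (2 * n)).ne'
  rw [szego_minus_eq, h.normRatio_edgeMeasure (isEdge_cMinus hμ hconj)
    (szego_minus_admissible hμ hconj), evalRatio_szegoE_neg_two hμ, evalRatio_szegoE_neg_two hμ,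
    normRatio_szegoE hμ, oddAlpha, mul_add_one]
  field_simp
  ring

/-- `4 - x² = (2 - x)(2 + x)`. This factorization gives access to `F` at `-2`, that of
`szego_o_eq_minus` to `F` at `2`. -/
lemma szego_o_eq_plus (hμ : NontrivialMeasure μ) (hconj : ConjInvariant μ) :
    szego μ .o = edgeMeasure (szego μ .plus) (cO μ ^ 2 / cPlus μ ^ 2) (-2) := by
  have hne : cPlus μ ^ 2 ≠ 0 := neg_ne_zero.1 (isEdge_cPlus hμ hconj).ne_zero
  rw [edgeMeasure, szego, szego, ← withDensity_mul _ (by fun_prop) (by fun_prop)]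
  have hne' := (pow_ne_zero_iff two_ne_zero).1 hne
  refine withDensity_congr_ae ?_
  -- `ENNReal.ofReal` is multiplicative here because `2 - x ≥ 0` on the support.
  filter_upwards [(szegoE_admissible hμ).ae_mem] with x hx
  rw [Pi.mul_apply, ← ENNReal.ofReal_mul (mul_nonneg (sq_nonneg _) (by linarith [hx.2]))]
  congr 1
  field_simp
  ring

lemma szego_o_eq_minus (hμ : NontrivialMeasure μ) (hconj : ConjInvariant μ) :
    szego μ .o = edgeMeasure (szego μ .minus) (-(cO μ ^ 2 / cMinus μ ^ 2)) 2 := by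
  have hne : cMinus μ ^ 2 ≠ 0 := (isEdge_cMinus hμ hconj).ne_zero
  rw [edgeMeasure, szego, szego, ← withDensity_mul _ (by fun_prop) (by fun_prop)]
  have hne' := (pow_ne_zero_iff two_ne_zero).1 hne
  refine withDensity_congr_ae ?_
  filter_upwards [(szegoE_admissible hμ).ae_mem] with x hx
  rw [Pi.mul_apply, ← ENNReal.ofReal_mul (mul_nonneg (sq_nonneg _) (by linarith [hx.1]))]
  congr 1
  field_simp
  ring

lemma cO_sq_pos (hμ : NontrivialMeasure μ) (hconj : ConjInvariant μ) : 0 < cO μ ^ 2 := by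
  have h := one_sub_alpha_pos hμ 1
  have h0 : 0 < 1 - alpha μ 0 ^ 2 := sub_pos.2 (alpha_sq_lt_one hμ 0)
  rw [cO_sq hμ hconj]
  positivity

lemma isEdge_o_plus (hμ : NontrivialMeasure μ) (hconj : ConjInvariant μ) :
    IsEdge (cO μ ^ 2 / cPlus μ ^ 2) (-2) := by
  have hne : cPlus μ ^ 2 ≠ 0 := neg_ne_zero.1 (isEdge_cPlus hμ hconj).ne_zero
  exact isEdge_neg_two (div_pos (cO_sq_pos hμ hconj) (lt_of_le_of_ne (sq_nonneg _) hne.symm))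

lemma isEdge_o_minus (hμ : NontrivialMeasure μ) (hconj : ConjInvariant μ) :
    IsEdge (-(cO μ ^ 2 / cMinus μ ^ 2)) 2 := by
  have hne : cMinus μ ^ 2 ≠ 0 := (isEdge_cMinus hμ hconj).ne_zero
  exact isEdge_two (neg_lt_zero.2
    (div_pos (cO_sq_pos hμ hconj) (lt_of_le_of_ne (sq_nonneg _) hne.symm)))

lemma szego_admissible (hμ : NontrivialMeasure μ) (hconj : ConjInvariant μ) (s : SzegoType) :
    Admissible (szego μ s) := by
  cases s with
  | e => exact szegoE_admissible hμ
  | plus => rw [szego_plus_eq]; exact szego_plus_admissible hμ hconj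
  | minus => rw [szego_minus_eq]; exact szego_minus_admissible hμ hconj
  | o =>
    have h : Admissible (szego μ .plus) := by
      rw [szego_plus_eq]; exact szego_plus_admissible hμ hconj
    rw [szego_o_eq_plus hμ hconj]
    refine h.edgeMeasure_admissible (isEdge_o_plus hμ hconj) ?_
    have h0 := (one_sub_alpha_pos hμ 0).ne'
    have h1 := (one_add_alpha_pos hμ 0).ne'
    have h2 := (one_sub_alpha_pos hμ 1).ne'
    have e : 1 - alpha μ 0 ^ 2 = (1 - alpha μ 0) * (1 + alpha μ 0) := by ring
    rw [h.integral_edge, evalRatio_szego_plus hμ hconj, cO_sq hμ hconj, cPlus_sq hμ hconj, e]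
    simp only [mul_zero, zero_add]
    field_simp

lemma ratioD_szego_plus (hμ : NontrivialMeasure μ) (hconj : ConjInvariant μ)
    (h1 : szegoE μ {2} = 0) (n : ℕ) : ratioD (szego μ .plus) n =
      (1 + alpha μ (2 * n + 1)) * (1 + alpha μ (2 * n)) := by
  have h := szegoE_admissible hμ
  have e1 := (sub_pos.2 (oddAlpha_lt_one hμ n)).ne'
  have e2 := (one_sub_alpha_pos hμ (2 * n)).ne'
  rw [ratioD, szego_plus_eq, h.F_ratio_edgeMeasure (isEdge_cPlus hμ hconj)
    (szego_plus_admissible hμ hconj) h1, normRatio_szegoE hμ, evalRatio_szegoE_two hμ]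
  field_simp
  ring

lemma ratioC_szego_minus (hμ : NontrivialMeasure μ) (hconj : ConjInvariant μ)
    (h1 : szegoE μ {-2} = 0) (n : ℕ) : ratioC (szego μ .minus) n =
      (1 + alpha μ (2 * n + 1)) * (1 - alpha μ (2 * n)) := by
  have h := szegoE_admissible hμ
  have e1 := (sub_pos.2 (oddAlpha_lt_one hμ n)).ne'
  have e2 := (one_add_alpha_pos hμ (2 * n)).ne'
  rw [ratioC, szego_minus_eq, h.F_ratio_edgeMeasure (isEdge_cMinus hμ hconj)
    (szego_minus_admissible hμ hconj) h1, normRatio_szegoE hμ, evalRatio_szegoE_neg_two hμ]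
  field_simp
  ring

/-- The source is (+), whose point `-2` is null by absolute continuity with respect to (e). -/
lemma ratioC_szego_o (hμ : NontrivialMeasure μ) (hconj : ConjInvariant μ)
    (h1 : szegoE μ {-2} = 0) (n : ℕ) : ratioC (szego μ .o) n =
      (1 - alpha μ (2 * n + 2)) * (1 + alpha μ (2 * n + 1)) := by
  have h := szego_admissible hμ hconj .plus
  have h' := szego_admissible hμ hconj .o
  have e1 := (one_sub_alpha_pos hμ (2 * n + 1)).ne'
  have e2 := (one_add_alpha_pos hμ (2 * n)).ne'
  rw [szego_o_eq_plus hμ hconj] at h'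
  rw [ratioC, szego_o_eq_plus hμ hconj, h.F_ratio_edgeMeasure (isEdge_o_plus hμ hconj) h'
    (withDensity_absolutelyContinuous _ _ h1), normRatio_szego_plus hμ hconj,
    evalRatio_szego_plus hμ hconj]
  field_simp
  ring

lemma ratioD_szego_o (hμ : NontrivialMeasure μ) (hconj : ConjInvariant μ)
    (h1 : szegoE μ {2} = 0) (n : ℕ) : ratioD (szego μ .o) n =
      (1 + alpha μ (2 * n + 2)) * (1 + alpha μ (2 * n + 1)) := by
  have h := szego_admissible hμ hconj .minus
  have h' := szego_admissible hμ hconj .o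
  have e1 := (one_sub_alpha_pos hμ (2 * n + 1)).ne'
  have e2 := (one_sub_alpha_pos hμ (2 * n)).ne'
  rw [szego_o_eq_minus hμ hconj] at h'
  rw [ratioD, szego_o_eq_minus hμ hconj, h.F_ratio_edgeMeasure (isEdge_o_minus hμ hconj) h'
    (withDensity_absolutelyContinuous _ _ h1), normRatio_szego_minus hμ hconj,
    evalRatio_szego_minus hμ hconj]
  field_simp
  ring

end Mappings

/-- Solving `x = (1 + u) (1 - v)`, `y = (1 - u) (1 - v)` for `u` and `v`. -/
lemma solve_ratios {x y u v : ℝ} (hv : 1 - v ≠ 0) (hx : x = (1 + u) * (1 - v))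
    (hy : y = (1 - u) * (1 - v)) :
    x + y ≠ 0 ∧ (u : ℂ) = (((x - y) / (x + y) : ℝ) : ℂ) ∧
      (v : ℂ) = ((1 - 1 / 2 * (x + y) : ℝ) : ℂ) := by
  have hs : x + y = 2 * (1 - v) := by rw [hx, hy]; ring
  have hne : x + y ≠ 0 := by rw [hs]; exact mul_ne_zero two_ne_zero hv
  refine ⟨hne, congrArg _ ?_, congrArg _ ?_⟩
  · rw [eq_div_iff hne, hx, hy]; ring
  · rw [hs]; ring

end

end InverseGeronimus

theorem mainTheorem3 (μ : Measure Circle) [IsProbabilityMeasure μ]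
    (hμ : NontrivialMeasure μ) (hconj : ConjInvariant μ) :
    -- the ratios are well defined
    (∀ (s : SzegoType) (n : ℕ), P (szego μ s) n 2 ≠ 0 ∧ P (szego μ s) n (-2) ≠ 0 ∧
      (MFinite (szego μ s) 2 → F (szego μ s) n 2 ≠ 0) ∧
      (MFinite (szego μ s) (-2) → F (szego μ s) n (-2) ≠ 0)) ∧
    -- the case (e)
    (∀ n : ℕ,
      ratioA (szego μ .e) n + ratioB (szego μ .e) n ≠ 0 ∧
      verblunsky μ (2 * n) =
        (((ratioA (szego μ .e) n - ratioB (szego μ .e) n) /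
          (ratioA (szego μ .e) n + ratioB (szego μ .e) n) : ℝ) : ℂ) ∧
      verblunsky μ (2 * n - 1) =
        ((1 - 1 / 2 * (ratioA (szego μ .e) n + ratioB (szego μ .e) n) : ℝ) : ℂ)) ∧
    -- the case (o)
    (μ {1} = 0 → μ {-1} = 0 →
      MFinite (szego μ .o) 2 ∧ MFinite (szego μ .o) (-2) ∧ ∀ n : ℕ,
      ratioC (szego μ .o) n + ratioD (szego μ .o) n ≠ 0 ∧
      -verblunsky μ (2 * n + 2) =
        (((ratioC (szego μ .o) n - ratioD (szego μ .o) n) /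
          (ratioC (szego μ .o) n + ratioD (szego μ .o) n) : ℝ) : ℂ) ∧
      -verblunsky μ (2 * n + 1) =
        ((1 - 1 / 2 * (ratioC (szego μ .o) n + ratioD (szego μ .o) n) : ℝ) : ℂ)) ∧
    -- the case (+)
    (μ {1} = 0 → MFinite (szego μ .plus) 2 ∧ ∀ n : ℕ,
      ratioA (szego μ .plus) n + ratioD (szego μ .plus) n ≠ 0 ∧
      -verblunsky μ (2 * n + 1) =
        (((ratioA (szego μ .plus) n - ratioD (szego μ .plus) n) /
          (ratioA (szego μ .plus) n + ratioD (szego μ .plus) n) : ℝ) : ℂ) ∧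
      -verblunsky μ (2 * n) =
        ((1 - 1 / 2 * (ratioA (szego μ .plus) n + ratioD (szego μ .plus) n) : ℝ) : ℂ)) ∧
    -- the case (-)
    (μ {-1} = 0 → MFinite (szego μ .minus) (-2) ∧ ∀ n : ℕ,
      ratioC (szego μ .minus) n + ratioB (szego μ .minus) n ≠ 0 ∧
      verblunsky μ (2 * n + 1) =
        (((ratioC (szego μ .minus) n - ratioB (szego μ .minus) n) /
          (ratioC (szego μ .minus) n + ratioB (szego μ .minus) n) : ℝ) : ℂ) ∧
      verblunsky μ (2 * n) =
        ((1 - 1 / 2 * (ratioC (szego μ .minus) n + ratioB (szego μ .minus) n) : ℝ) : ℂ)) := by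
  have v0 : ∀ n : ℕ, verblunsky μ (2 * n) = alpha μ (2 * n) := fun n => by
    exact_mod_cast verblunsky_eq hconj (2 * n)
  have v1 : ∀ n : ℕ, verblunsky μ (2 * n + 1) = alpha μ (2 * n + 1) := fun n => by
    exact_mod_cast verblunsky_eq hconj (2 * n + 1)
  have v2 : ∀ n : ℕ, verblunsky μ (2 * n + 2) = alpha μ (2 * n + 2) := fun n => by
    exact_mod_cast verblunsky_eq hconj (2 * n + 2)
  have vm : ∀ n : ℕ, verblunsky μ (2 * n - 1) = oddAlpha μ n := fun n => by
    cases n with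
    -- The index `2 * 0 - 1` is `Int.negSucc 0`, the branch with value `-1`.
    | zero => simp [oddAlpha]; rfl
    | succ n =>
      rw [show (2 * ((n + 1 : ℕ) : ℤ) - 1) = 2 * (n : ℤ) + 1 by push_cast; ring, v1, oddAlpha]
  have hA := szego_admissible hμ hconj
  -- `mFinite_edgeMeasure` needs the source measures to be finite.
  have := (hA .plus).prob
  have := (hA .minus).prob
  have : IsProbabilityMeasure (szegoE μ) := (hA .e).prob
  refine ⟨fun s n => ⟨(hA s).P_ne_zero (isEdge_two neg_one_lt_zero) n,
    (hA s).P_ne_zero (isEdge_neg_two one_pos) n,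
    fun hm => (hA s).F_ne_zero (isEdge_two neg_one_lt_zero) hm n,
    fun hm => (hA s).F_ne_zero (isEdge_neg_two one_pos) hm n⟩, fun n => ?_, fun h1 h2 => ?_,
    fun h1 => ?_, fun h1 => ?_⟩
  · rw [v0, vm]
    refine solve_ratios (sub_pos.2 (oddAlpha_lt_one hμ n)).ne' ?_ (evalRatio_szegoE_two hμ n)
    exact neg_eq_iff_eq_neg.2 (evalRatio_szegoE_neg_two hμ n)
  · refine ⟨?_, ?_, fun n => ?_⟩
    · rw [szego_o_eq_minus hμ hconj]; exact mFinite_edgeMeasure _ _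
    · rw [szego_o_eq_plus hμ hconj]; exact mFinite_edgeMeasure _ _
    -- Here `u = -α_{2n+2}` and `v = -α_{2n+1}`.
    · rw [v1, v2, ← Complex.ofReal_neg, ← Complex.ofReal_neg]
      refine solve_ratios ?_ ?_ ?_
      · rw [sub_neg_eq_add]; exact (one_add_alpha_pos hμ _).ne'
      · rw [ratioC_szego_o hμ hconj (szegoE_neg_two h2)]; ring
      · rw [ratioD_szego_o hμ hconj (szegoE_two h1)]; ring
  · refine ⟨?_, fun n => ?_⟩
    · rw [szego_plus_eq]; exact mFinite_edgeMeasure _ _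
    -- Here `u = -α_{2n+1}` and `v = -α_{2n}`.
    · rw [v0, v1, ← Complex.ofReal_neg, ← Complex.ofReal_neg]
      refine solve_ratios ?_ ?_ ?_
      · rw [sub_neg_eq_add]; exact (one_add_alpha_pos hμ _).ne'
      · refine (neg_eq_iff_eq_neg.2 (evalRatio_szego_plus hμ hconj n)).trans ?_
        ring
      · rw [ratioD_szego_plus hμ hconj (szegoE_two h1)]; ring
  · refine ⟨?_, fun n => ?_⟩
    · rw [szego_minus_eq]; exact mFinite_edgeMeasure _ _
    · rw [v0, v1]
      exact solve_ratios (one_sub_alpha_pos hμ _).ne'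
        (ratioC_szego_minus hμ hconj (szegoE_neg_two h1) n) (evalRatio_szego_minus hμ hconj n)
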